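/- Proposition 2.2. Let $(M,g)$ be a smooth Riemannian manifold (without boundary) with Levi-Civita connection $\nabla^g$, and let $T$ be a smooth 3-form on $M$. Let $\nabla^T$ be the connection with totally skew-symmetric torsion $T$, defined by $$g(\nabla^T_XY,Z)=g(\nabla^g_XY,Z)+\tfrac12\,T(X,Y,Z),$$ and define the vector field $T(X,Y)$ by $g(T(X,Y),Z)=T(X,Y,Z)$. A Riemannian manifold $(N,h)$ is called Kähler with torsion, with Bismut torsion the 3-form $B$, if there is a complex structure $J$ on $N$ (a smooth endomorphism field with $J^2=-1$ and vanishing Nijenhuis tensor) such that $h(JX,JY)=h(X,Y)$ and $\nabla^BJ=0$, where $\nabla^B$ is the connection of $(N,h)$ with totally skew-symmetric torsion $B$. The triple $(M,g,T)$ is called Sasaki with torsion if its metric cone $(M\times\mathbb R_{>0},\ dr^2+r^2g)$ is Kähler with torsion, with Bismut torsion $r^2T$. For a vector field $\xi$ on $M$ put $\eta=g(\xi,\cdot)$, $\Phi(X)=\nabla^T_X\xi$ and $(d^T\eta)(X,Y)=(\nabla^T_X\eta)(Y)-(\nabla^T_Y\eta)(X)$, and consider the following conditions, for all vector fields $X,Y$: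 (a) $\nabla^T_X(d^T\eta)=-2\,X^\flat\wedge\eta$, where $X^\flat=g(X,\cdot)$ and $(\alpha\wedge\beta)(Y,Z)=\alpha(Y)\beta(Z)-\alpha(Z)\beta(Y)$; (b) $(\nabla^T_X\Phi)(Y)=g(\xi,Y)X-g(X,Y)\xi$; (c) $R^T(X,Y)\xi=g(\xi,Y)X-g(\xi,X)Y+\Phi(T(X,Y))$, where $R^T(X,Y)Z=\nabla^T_X\nabla^T_YZ-\nabla^T_Y\nabla^T_XZ-\nabla^T_{[X,Y]}Z$. Then, for each one of the conditions (a), (b), (c): $(M,g,T)$ is Sasaki with torsion if and only if there exists a Killing vector field $\xi$ of unit length on $M$ which satisfies that condition and for which $$T(X,Y,Z)=T(X,\Phi(Y),\Phi(Z))+T(\Phi(X),Y,\Phi(Z))+T(\Phi(X),\Phi(Y),Z)$$ for all vector fields $X,Y,Z$. -/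

import Mathlib

open scoped Manifold ContDiff

namespace SasakiTorsion

open Bundle Set Filter Topology FiberBundle VectorField

noncomputable section

set_option linter.unusedSectionVars false

section Geometry

variable {E : Type*} [NormedAddCommGroup E] [NormedSpace ℝ E]
  {H : Type*} [TopologicalSpace H] {I : ModelWithCorners ℝ E H}
  {M : Type*} [TopologicalSpace M] [ChartedSpace H M] [IsManifold I ∞ M]

variable (I M) in
/-- A (not necessarily continuous) vector field. -/
abbrev VField := Π x : M, TangentSpace I x

/-- Smoothness of a vector field, as a section of the tangent bundle. -/
def IsSmooth (X : VField I M) : Prop :=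
  ContMDiff I (I.prod 𝓘(ℝ, E)) ∞ (fun x ↦ (TotalSpace.mk' E x (X x) : TangentBundle I M))

/-- Smoothness of a vector field near a point. -/
def SmoothAt (X : VField I M) (x : M) : Prop :=
  ContMDiffAt I (I.prod 𝓘(ℝ, E)) ∞ (fun x ↦ (TotalSpace.mk' E x (X x) : TangentBundle I M)) x

variable (I M) in
/-- Smooth Riemannian metrics on `M`. -/
abbrev Metric := ContMDiffRiemannianMetric I ∞ E (TangentSpace I : M → Type _)

variable (g : Metric I M)

/-- The function `g(X, Y)`. -/
def pair (X Y : VField I M) : M → ℝ := fun x ↦ g.inner x (X x) (Y x)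

/-- The function `X f`, the derivative of `f` along `X`. -/
def dirDeriv (X : VField I M) (f : M → ℝ) : M → ℝ := fun x ↦ mvfderiv I f x (X x)

/-- One half of the right-hand side of the Koszul formula, i.e. the function `g(∇_X Y, Z)`
for the Levi-Civita connection `∇` of `g`. -/
def koszul (X Y Z : VField I M) (x : M) : ℝ :=
  (1 / 2) * (dirDeriv X (pair g Y Z) x + dirDeriv Y (pair g X Z) x - dirDeriv Z (pair g X Y) x
    + pair g (mlieBracket I X Y) Z x - pair g (mlieBracket I X Z) Y x
    - pair g (mlieBracket I Y Z) X x)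

variable {g}

lemma mdifferentiableAt_pair {X Y : VField I M} {x : M}
    (hX : MDiffAt (T% X) x) (hY : MDiffAt (T% Y) x) : MDiffAt (pair g X Y) x := by
  have h : MDifferentiableAt I (I.prod 𝓘(ℝ)) (fun y ↦ TotalSpace.mk' ℝ
      (E := Bundle.Trivial M ℝ) y (g.inner y (X y) (Y y))) x := by
    apply MDifferentiableAt.clm_bundle_apply₂ (F₁ := E) (F₂ := E)
    · exact g.contMDiff.mdifferentiableAt (by simp)
    · exact hX
    · exact hY
  simp only [mdifferentiableAt_totalSpace] at h
  exact h.2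

variable (I M) in
/-- Smooth 3-forms on `M`: pointwise alternating trilinear forms on the tangent spaces whose
values on (locally defined) smooth vector fields are smooth functions. -/
structure ThreeForm where
  form (x : M) : TangentSpace I x [⋀^Fin 3]→L[ℝ] ℝ
  smooth : ∀ (x : M) (X Y Z : VField I M), SmoothAt X x → SmoothAt Y x → SmoothAt Z x →
    ContMDiffAt I 𝓘(ℝ) ∞ (fun y ↦ form y ![X y, Y y, Z y]) x

/-- The value `T(u, v, w)` at the point `x`. -/
def ThreeForm.eval (T : ThreeForm I M) (x : M) (u v w : TangentSpace I x) : ℝ :=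
  T.form x ![u, v, w]

namespace ThreeForm

variable (T : ThreeForm I M)

lemma eval_add_left (x : M) (u u' v w : TangentSpace I x) :
    T.eval x (u + u') v w = T.eval x u v w + T.eval x u' v w := by
  have e : ∀ a : TangentSpace I x, Function.update ![0, v, w] 0 a = ![a, v, w] := fun a ↦ by
    ext i; fin_cases i <;> rfl
  have h := (T.form x).map_update_add ![0, v, w] 0 u u'
  rwa [e, e, e] at h

lemma eval_smul_left (x : M) (c : ℝ) (u v w : TangentSpace I x) :
    T.eval x (c • u) v w = c * T.eval x u v w := by
  have e : ∀ a : TangentSpace I x, Function.update ![0, v, w] 0 a = ![a, v, w] := fun a ↦ by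
    ext i; fin_cases i <;> rfl
  have h := (T.form x).map_update_smul ![0, v, w] 0 c u
  rwa [e, e] at h

lemma eval_add_mid (x : M) (u v v' w : TangentSpace I x) :
    T.eval x u (v + v') w = T.eval x u v w + T.eval x u v' w := by
  have e : ∀ a : TangentSpace I x, Function.update ![u, 0, w] 1 a = ![u, a, w] := fun a ↦ by
    ext i; fin_cases i <;> rfl
  have h := (T.form x).map_update_add ![u, 0, w] 1 v v'
  rwa [e, e, e] at h

lemma eval_smul_mid (x : M) (c : ℝ) (u v w : TangentSpace I x) :
    T.eval x u (c • v) w = c * T.eval x u v w := by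
  have e : ∀ a : TangentSpace I x, Function.update ![u, 0, w] 1 a = ![u, a, w] := fun a ↦ by
    ext i; fin_cases i <;> rfl
  have h := (T.form x).map_update_smul ![u, 0, w] 1 c v
  rwa [e, e] at h

lemma eval_add_right (x : M) (u v w w' : TangentSpace I x) :
    T.eval x u v (w + w') = T.eval x u v w + T.eval x u v w' := by
  have e : ∀ a : TangentSpace I x, Function.update ![u, v, 0] 2 a = ![u, v, a] := fun a ↦ by
    ext i; fin_cases i <;> rfl
  have h := (T.form x).map_update_add ![u, v, 0] 2 w w'
  rwa [e, e, e] at h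

lemma eval_smul_right (x : M) (c : ℝ) (u v w : TangentSpace I x) :
    T.eval x u v (c • w) = c * T.eval x u v w := by
  have e : ∀ a : TangentSpace I x, Function.update ![u, v, 0] 2 a = ![u, v, a] := fun a ↦ by
    ext i; fin_cases i <;> rfl
  have h := (T.form x).map_update_smul ![u, v, 0] 2 c w
  rwa [e, e] at h

end ThreeForm

variable [FiniteDimensional ℝ E]

lemma koszul_tensorial_left {Y Z : VField I M} {x : M}
    (hY : MDiffAt (T% Y) x) (hZ : MDiffAt (T% Z) x) :
    TensorialAt I E (fun X : VField I M ↦ koszul g X Y Z x) x where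
  smul {f X} hf hX := by
    have := FiniteDimensional.complete ℝ E
    have h1 : pair g (f • X) Z = fun y ↦ f y * pair g X Z y := by
      ext y; simp [pair]
    have h2 : pair g (f • X) Y = fun y ↦ f y * pair g X Y y := by
      ext y; simp [pair]
    simp only [koszul, dirDeriv, h1, h2]
    rw [mvfderiv_fun_mul hf (mdifferentiableAt_pair hX hZ),
      mvfderiv_fun_mul hf (mdifferentiableAt_pair hX hY)]
    simp only [pair]
    rw [mlieBracket_smul_left hf hX, mlieBracket_smul_left hf hX]
    simp [g.symm x (X x)]
    ring
  add {X X'} hX hX' := by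
    have := FiniteDimensional.complete ℝ E
    have h1 : pair g (X + X') Z = fun y ↦ pair g X Z y + pair g X' Z y := by
      ext y; simp [pair]
    have h2 : pair g (X + X') Y = fun y ↦ pair g X Y y + pair g X' Y y := by
      ext y; simp [pair]
    simp only [koszul, dirDeriv, h1, h2]
    rw [mvfderiv_fun_add (mdifferentiableAt_pair hX hZ) (mdifferentiableAt_pair hX' hZ),
      mvfderiv_fun_add (mdifferentiableAt_pair hX hY) (mdifferentiableAt_pair hX' hY)]
    simp only [pair]
    rw [mlieBracket_add_left hX hX', mlieBracket_add_left hX hX']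
    simp
    ring

lemma koszul_tensorial_right {X Y : VField I M} {x : M}
    (hX : MDiffAt (T% X) x) (hY : MDiffAt (T% Y) x) :
    TensorialAt I E (fun Z : VField I M ↦ koszul g X Y Z x) x where
  smul {f Z} hf hZ := by
    have := FiniteDimensional.complete ℝ E
    have h1 : pair g X (f • Z) = fun y ↦ f y * pair g X Z y := by
      ext y; simp [pair]
    have h2 : pair g Y (f • Z) = fun y ↦ f y * pair g Y Z y := by
      ext y; simp [pair]
    simp only [koszul, dirDeriv, h1, h2]
    rw [mvfderiv_fun_mul hf (mdifferentiableAt_pair hX hZ),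
      mvfderiv_fun_mul hf (mdifferentiableAt_pair hY hZ)]
    simp only [pair]
    rw [mlieBracket_smul_right hf hZ, mlieBracket_smul_right hf hZ]
    simp [g.symm x (Z x)]
    ring
  add {Z Z'} hZ hZ' := by
    have := FiniteDimensional.complete ℝ E
    have h1 : pair g X (Z + Z') = fun y ↦ pair g X Z y + pair g X Z' y := by
      ext y; simp [pair]
    have h2 : pair g Y (Z + Z') = fun y ↦ pair g Y Z y + pair g Y Z' y := by
      ext y; simp [pair]
    simp only [koszul, dirDeriv, h1, h2]
    rw [mvfderiv_fun_add (mdifferentiableAt_pair hX hZ) (mdifferentiableAt_pair hX hZ'),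
      mvfderiv_fun_add (mdifferentiableAt_pair hY hZ) (mdifferentiableAt_pair hY hZ')]
    simp only [pair]
    rw [mlieBracket_add_right hZ hZ', mlieBracket_add_right hZ hZ']
    simp
    ring

lemma koszul_add {X Y Y' Z : VField I M} {x : M} (hX : MDiffAt (T% X) x)
    (hY : MDiffAt (T% Y) x) (hY' : MDiffAt (T% Y') x) (hZ : MDiffAt (T% Z) x) :
    koszul g X (Y + Y') Z x = koszul g X Y Z x + koszul g X Y' Z x := by
  have := FiniteDimensional.complete ℝ E
  have h1 : pair g (Y + Y') Z = fun y ↦ pair g Y Z y + pair g Y' Z y := by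
    ext y; simp [pair]
  have h2 : pair g X (Y + Y') = fun y ↦ pair g X Y y + pair g X Y' y := by
    ext y; simp [pair]
  simp only [koszul, dirDeriv, h1, h2]
  rw [mvfderiv_fun_add (mdifferentiableAt_pair hY hZ) (mdifferentiableAt_pair hY' hZ),
    mvfderiv_fun_add (mdifferentiableAt_pair hX hY) (mdifferentiableAt_pair hX hY')]
  simp only [pair]
  rw [mlieBracket_add_left hY hY', mlieBracket_add_right hY hY']
  simp
  ring

lemma koszul_leibniz {f : M → ℝ} {X Y Z : VField I M} {x : M} (hf : MDiffAt f x)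
    (hX : MDiffAt (T% X) x) (hY : MDiffAt (T% Y) x) (hZ : MDiffAt (T% Z) x) :
    koszul g X (f • Y) Z x = f x * koszul g X Y Z x + dirDeriv X f x * pair g Y Z x := by
  have := FiniteDimensional.complete ℝ E
  have h1 : pair g (f • Y) Z = fun y ↦ f y * pair g Y Z y := by
    ext y; simp [pair]
  have h2 : pair g X (f • Y) = fun y ↦ f y * pair g X Y y := by
    ext y; simp [pair]
  simp only [koszul, dirDeriv, h1, h2]
  rw [mvfderiv_fun_mul hf (mdifferentiableAt_pair hY hZ),
    mvfderiv_fun_mul hf (mdifferentiableAt_pair hX hY)]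
  simp only [pair]
  rw [mlieBracket_smul_left hf hY, mlieBracket_smul_right hf hY]
  simp [g.symm x (X x)]
  ring

variable (g)

/-- The musical isomorphism `T_x M ≃ T_x^* M`, `v ↦ g(v, ·)`. -/
def flat (x : M) : TangentSpace I x ≃L[ℝ] (TangentSpace I x →L[ℝ] ℝ) :=
  haveI : FiniteDimensional ℝ (TangentSpace I x) := inferInstanceAs (FiniteDimensional ℝ E)
  haveI : T2Space (TangentSpace I x) := inferInstanceAs (T2Space E)
  haveI : FiniteDimensional ℝ (TangentSpace I x →L[ℝ] ℝ) :=
    LinearMap.toContinuousLinearMap.finiteDimensional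
  LinearEquiv.toContinuousLinearEquiv
    (LinearEquiv.ofInjectiveOfFinrankEq (g.inner x : TangentSpace I x →ₗ[ℝ] _) (by
      rw [injective_iff_map_eq_zero]
      intro v hv
      by_contra h
      have := g.pos x v h
      have h' : g.inner x v = 0 := hv
      simp [h'] at this) (by
      rw [← LinearMap.toContinuousLinearMap.finrank_eq]
      exact (Subspace.dual_finrank_eq).symm))

@[simp] lemma flat_apply (x : M) (v w : TangentSpace I x) : flat g x v w = g.inner x v w := rfl


/-- The Levi-Civita connection of `g`, determined by the Koszul formula
(its values on vector fields that are not differentiable at the point are set to `0`). -/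
def leviCivita : CovariantDerivative I E (TangentSpace I : M → Type _) where
  toFun Y x :=
    open Classical in
    if hY : MDiffAt (T% Y) x then
      ((flat g x).symm : (TangentSpace I x →L[ℝ] ℝ) →L[ℝ] TangentSpace I x).comp
        (TensorialAt.mkHom₂ (F := E) (F' := E) (fun X Z : VField I M ↦ koszul g X Y Z x) x
          (fun _ hZ ↦ koszul_tensorial_left hY hZ) (fun _ hX ↦ koszul_tensorial_right hX hY))
    else 0
  isCovariantDerivativeOnUniv :=
    { add := by
        intro Y Y' x hY hY' _
        have hs : MDiffAt (T% (Y + Y')) x := mdifferentiableAt_add_section hY hY'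
        simp only [hY, hY', hs, dif_pos]
        rw [← ContinuousLinearMap.comp_add]
        congr 1
        ext u w
        simp only [TensorialAt.mkHom₂_apply_eq_extend, add_apply]
        exact koszul_add (mdifferentiableAt_extend ..) hY hY' (mdifferentiableAt_extend ..)
      leibniz := by
        intro Y f x hY hf _
        have hs : MDiffAt (T% (f • Y)) x := hf.smul_section hY
        simp only [hY, hs, dif_pos]
        ext u
        apply (flat g x).injective
        ext w
        simp only [ContinuousLinearMap.comp_apply, add_apply, smul_apply, map_add, map_smul,
          ContinuousLinearMap.smulRight_apply, ContinuousLinearEquiv.coe_coe,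
          ContinuousLinearEquiv.apply_symm_apply, flat_apply,
          TensorialAt.mkHom₂_apply_eq_extend]
        rw [koszul_leibniz hf (mdifferentiableAt_extend ..) hY (mdifferentiableAt_extend ..)]
        simp [dirDeriv, pair] }

/-- The Koszul formula: `g(∇_X Y, Z)` is one half of the Koszul expression. -/
theorem inner_leviCivita {X Y Z : VField I M} {x : M} (hX : MDiffAt (T% X) x)
    (hY : MDiffAt (T% Y) x) (hZ : MDiffAt (T% Z) x) :
    g.inner x (leviCivita g Y x (X x)) (Z x) = koszul g X Y Z x := by
  rw [← flat_apply]
  simp only [leviCivita, hY, dif_pos]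
  simp only [ContinuousLinearMap.comp_apply, ContinuousLinearEquiv.coe_coe,
    ContinuousLinearEquiv.apply_symm_apply]
  exact TensorialAt.mkHom₂_apply _ _ hX hZ

variable (T : ThreeForm I M)

/-- The vector `T(u, v)` determined by `g(T(u, v), w) = T(u, v, w)`. -/
def torsionVec (x : M) (u v : TangentSpace I x) : TangentSpace I x :=
  haveI : FiniteDimensional ℝ (TangentSpace I x) := inferInstanceAs (FiniteDimensional ℝ E)
  haveI : T2Space (TangentSpace I x) := inferInstanceAs (T2Space E)
  (flat g x).symm (LinearMap.toContinuousLinearMap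
    { toFun := fun w ↦ T.eval x u v w
      map_add' := T.eval_add_right x u v
      map_smul' := fun c w ↦ T.eval_smul_right x c u v w })

@[simp] lemma inner_torsionVec (x : M) (u v w : TangentSpace I x) :
    g.inner x (torsionVec g T x u v) w = T.eval x u v w := by
  rw [← flat_apply, torsionVec, ContinuousLinearEquiv.apply_symm_apply]
  rfl

/-- The linear map `u ↦ T(u, v)`. -/
def torsionVecLeft (x : M) (v : TangentSpace I x) : TangentSpace I x →L[ℝ] TangentSpace I x :=
  haveI : FiniteDimensional ℝ (TangentSpace I x) := inferInstanceAs (FiniteDimensional ℝ E)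
  haveI : T2Space (TangentSpace I x) := inferInstanceAs (T2Space E)
  LinearMap.toContinuousLinearMap
    { toFun := fun u ↦ torsionVec g T x u v
      map_add' := by
        intro u u'
        apply (flat g x).injective
        ext w
        simp [T.eval_add_left]
      map_smul' := by
        intro c u
        apply (flat g x).injective
        ext w
        simp [T.eval_smul_left] }

lemma inner_torsionVecLeft (x : M) (u v w : TangentSpace I x) :
    g.inner x (torsionVecLeft g T x v u) w = T.eval x u v w :=
  inner_torsionVec g T x u v w

/-- The connection with totally skew-symmetric torsion `T`:
`g(∇^T_X Y, Z) = g(∇^g_X Y, Z) + T(X, Y, Z) / 2`. -/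
def torsionConnection : CovariantDerivative I E (TangentSpace I : M → Type _) where
  toFun Y x := leviCivita g Y x + (1 / 2 : ℝ) • torsionVecLeft g T x (Y x)
  isCovariantDerivativeOnUniv :=
    { add := by
        intro Y Y' x hY hY' _
        rw [(leviCivita g).isCovariantDerivativeOnUniv.add hY hY']
        ext u
        apply (flat g x).injective
        ext w
        simp [inner_torsionVecLeft, T.eval_add_mid]
        ring
      leibniz := by
        intro Y f x hY hf _
        rw [(leviCivita g).isCovariantDerivativeOnUniv.leibniz hY hf]
        ext u
        apply (flat g x).injective
        ext w
        simp [inner_torsionVecLeft, T.eval_smul_mid]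
        ring }

theorem inner_torsionConnection (Y : VField I M) (x : M) (u w : TangentSpace I x) :
    g.inner x (torsionConnection g T Y x u) w =
      g.inner x (leviCivita g Y x u) w + 1 / 2 * T.eval x u (Y x) w := by
  have h : torsionConnection g T Y x u
      = leviCivita g Y x u + (1 / 2 : ℝ) • torsionVec g T x u (Y x) := rfl
  rw [h]
  simp


/-- A family of linear maps `TM → V` is smooth as soon as it maps smooth vector fields
to smooth sections. -/
lemma contMDiffAt_hom_of_apply {F : Type*} [NormedAddCommGroup F] [NormedSpace ℝ F]
    {V : M → Type*} [TopologicalSpace (TotalSpace F V)] [∀ x, AddCommGroup (V x)]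
    [∀ x, Module ℝ (V x)] [∀ x, TopologicalSpace (V x)] [FiberBundle F V] [VectorBundle ℝ F V]
    [∀ x, IsTopologicalAddGroup (V x)] [∀ x, ContinuousSMul ℝ (V x)]
    (L : ∀ x : M, TangentSpace I x →L[ℝ] V x) (x₀ : M)
    (h : ∀ X : VField I M, SmoothAt X x₀ →
      ContMDiffAt I (I.prod 𝓘(ℝ, F)) ∞ (fun x ↦ TotalSpace.mk' F x (L x (X x))) x₀) :
    ContMDiffAt I (I.prod 𝓘(ℝ, E →L[ℝ] F)) ∞
      (fun x ↦ TotalSpace.mk' (E →L[ℝ] F) (E := fun x : M ↦ TangentSpace I x →L[ℝ] V x)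
        x (L x)) x₀ := by
  rw [contMDiffAt_hom_bundle]
  refine ⟨contMDiffAt_id, ?_⟩
  simp only
  set f : M → E →L[ℝ] F := fun x ↦ ContinuousLinearMap.inCoordinates E
    (TangentSpace I : M → Type _) F V x₀ x x₀ x (L x) with hf
  let t := trivializationAt E (TangentSpace I : M → Type _) x₀
  let t' := trivializationAt F V x₀
  have hx₀ : x₀ ∈ t.baseSet := mem_baseSet_trivializationAt ..
  have hx₀' : x₀ ∈ t'.baseSet := mem_baseSet_trivializationAt ..
  have hv : ∀ v : E, ContMDiffAt I 𝓘(ℝ, F) ∞ (fun x ↦ f x v) x₀ := by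
    intro v
    have hX : SmoothAt (extend E (t.symm x₀ v)) x₀ := contMDiffAt_extend I E _
    have h1 := (contMDiffAt_section _).1 (h _ hX)
    refine h1.congr_of_eventuallyEq ?_
    filter_upwards [t.open_baseSet.mem_nhds hx₀, t'.open_baseSet.mem_nhds hx₀'] with x hx hx'
    have hw : (t ⟨x₀, t.symm x₀ v⟩).2 = v := by
      rw [t.apply_mk_symm hx₀]
    simp only [hf, ContinuousLinearMap.inCoordinates, ContinuousLinearMap.comp_apply, extend]
    rw [Trivialization.continuousLinearMapAt_apply, Trivialization.coe_linearMapAt_of_mem _ hx']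
    change _ = (t' ⟨x, L x (t.symm x (t ⟨x₀, t.symm x₀ v⟩).2)⟩).2
    rw [hw, Trivialization.symmL_apply _ hx]
  let b := Module.finBasis ℝ E
  have hsum : f = fun x ↦ ∑ i, ((b.coord i).toContinuousLinearMap).smulRight (f x (b i)) := by
    ext x v
    simp only [sum_apply, ContinuousLinearMap.smulRight_apply]
    conv_lhs => rw [← b.sum_repr v, map_sum]
    simp only [map_smul]
    rfl
  rw [hsum]
  apply ContMDiffAt.sum
  intro i _
  exact ((ContinuousLinearMap.smulRightL ℝ E F
    ((b.coord i).toContinuousLinearMap)).contMDiff.contMDiffAt).comp x₀ (hv (b i))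


end Geometry

section Cone

variable {E : Type*} [NormedAddCommGroup E] [NormedSpace ℝ E]
  {H : Type*} [TopologicalSpace H] {I : ModelWithCorners ℝ E H}
  {M : Type*} [TopologicalSpace M] [ChartedSpace H M] [IsManifold I ∞ M]

/-- The open half-line `ℝ₊ = (0, ∞)`, as an open submanifold of `ℝ`. -/
abbrev HalfLine : TopologicalSpace.Opens ℝ := ⟨Set.Ioi 0, isOpen_Ioi⟩

variable (M) in
/-- The cone `C(M) = M × ℝ₊`, a manifold modelled on `I.prod 𝓘(ℝ)`. -/
abbrev Cone : Type _ := M × HalfLine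

/-- The radial function `r` on the cone. -/
def radius (p : Cone M) : ℝ := p.2.1

variable (I) in
/-- The 1-form `dr` on the cone. -/
def dr (p : Cone M) : TangentSpace (I.prod 𝓘(ℝ)) p →L[ℝ] ℝ :=
  mvfderiv (I.prod 𝓘(ℝ)) radius p

variable (I) in
/-- The differential of the projection `C(M) → M`. -/
def dproj (p : Cone M) : TangentSpace (I.prod 𝓘(ℝ)) p →L[ℝ] TangentSpace I p.1 :=
  mfderiv (I.prod 𝓘(ℝ)) I Prod.fst p

lemma radius_pos (p : Cone M) : 0 < radius p := p.2.2

lemma contMDiff_radius : ContMDiff (I.prod 𝓘(ℝ)) 𝓘(ℝ) ∞ (radius : Cone M → ℝ) :=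
  contMDiff_subtype_val.comp contMDiff_snd

lemma dproj_apply (p : Cone M) (u : TangentSpace (I.prod 𝓘(ℝ)) p) : dproj I p u = u.1 := by
  simp only [dproj, mfderiv_fst]
  rfl

lemma halfLine_mfderiv_injective (r : HalfLine) :
    Function.Injective (mfderiv 𝓘(ℝ) 𝓘(ℝ) (Subtype.val : HalfLine → ℝ) r) := by
  classical
  let h : ℝ → HalfLine := fun s ↦ if hs : 0 < s then ⟨s, hs⟩ else ⟨1, one_pos (α := ℝ)⟩
  have h1 : ContMDiffAt 𝓘(ℝ) 𝓘(ℝ) ∞ h r.1 := by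
    rw [← ContMDiffAt.subtypeVal_comp_iff]
    refine contMDiffAt_id.congr_of_eventuallyEq ?_
    filter_upwards [isOpen_Ioi.mem_nhds r.2] with s hs
    have hs' : 0 < s := hs
    simp [h, hs']
  have h2 : h ∘ (Subtype.val : HalfLine → ℝ) = id := by
    ext s
    have hs' : 0 < s.1 := s.2
    simp [h, hs']
  have h3 := mfderiv_comp r (h1.mdifferentiableAt (by simp))
    ((contMDiff_subtype_val (n := ∞) (I := 𝓘(ℝ)) (U := HalfLine) r).mdifferentiableAt (by simp))
  rw [h2, mfderiv_id] at h3
  intro u v huv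
  have key : ∀ w : TangentSpace 𝓘(ℝ) r, w = mfderiv 𝓘(ℝ) 𝓘(ℝ) h r.1
      (mfderiv 𝓘(ℝ) 𝓘(ℝ) (Subtype.val : HalfLine → ℝ) r w) := fun w ↦ congrArg (fun L ↦ L w) h3
  rw [key u, key v, huv]

lemma dr_apply (p : Cone M) (u : TangentSpace (I.prod 𝓘(ℝ)) p) :
    dr I p u = mfderiv 𝓘(ℝ) 𝓘(ℝ) (Subtype.val : HalfLine → ℝ) p.2 u.2 := by
  have h := mfderiv_comp (I := I.prod 𝓘(ℝ)) (I' := 𝓘(ℝ)) (I'' := 𝓘(ℝ)) p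
    ((contMDiff_subtype_val (n := ∞) (I := 𝓘(ℝ)) (U := HalfLine) p.2).mdifferentiableAt (by simp))
    (mdifferentiableAt_snd (I := I) (I' := 𝓘(ℝ)) (x := p))
  have e : (radius : Cone M → ℝ) = (Subtype.val : HalfLine → ℝ) ∘ Prod.snd := rfl
  unfold dr mvfderiv
  rw [e, h, mfderiv_snd]
  rfl

lemma eq_zero_of_dr_dproj {p : Cone M} {u : TangentSpace (I.prod 𝓘(ℝ)) p}
    (h1 : dr I p u = 0) (h2 : dproj I p u = 0) : u = 0 := by
  rw [dproj_apply] at h2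
  rw [dr_apply] at h1
  have h3 : u.2 = 0 := halfLine_mfderiv_injective p.2 (h1.trans (map_zero _).symm)
  exact Prod.ext h2 h3

variable [FiniteDimensional ℝ E]

/-- A positive definite bilinear form on a finite-dimensional space has bounded unit ball. -/
lemma isVonNBounded_of_posDef {V : Type*} [NormedAddCommGroup V] [NormedSpace ℝ V]
    [FiniteDimensional ℝ V] (b : V →L[ℝ] V →L[ℝ] ℝ) (hb : ∀ v, v ≠ 0 → 0 < b v v) :
    Bornology.IsVonNBounded ℝ {v : V | b v v < 1} := by
  rw [NormedSpace.isVonNBounded_iff]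
  have hc : Continuous fun v : V ↦ b v v := by fun_prop
  have := FiniteDimensional.proper ℝ V
  rcases (Metric.sphere (0 : V) 1).eq_empty_or_nonempty with he | hne
  · refine (Metric.isBounded_closedBall (x := (0 : V)) (r := 0)).subset fun v _ ↦ ?_
    by_contra hv
    have hv' : ‖v‖ ≠ 0 := by
      intro h
      apply hv
      rw [norm_eq_zero] at h
      simp [h]
    have : ‖v‖⁻¹ • v ∈ Metric.sphere (0 : V) 1 := by
      simp [norm_smul, hv']
    rw [he] at this
    exact this
  · obtain ⟨w, hw, hmin⟩ := (isCompact_sphere (0 : V) 1).exists_isMinOn hne hc.continuousOn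
    have hw0 : w ≠ 0 := by
      rintro rfl
      simp at hw
    set m := b w w with hm
    have hmpos : 0 < m := hb w hw0
    refine (Metric.isBounded_closedBall (x := (0 : V)) (r := max 1 m⁻¹)).subset fun v hv ↦ ?_
    rw [mem_closedBall_zero_iff]
    by_contra hlt
    push Not at hlt
    have hv1 : 1 < ‖v‖ := (le_max_left _ _).trans_lt hlt
    have hv2 : m⁻¹ < ‖v‖ := (le_max_right _ _).trans_lt hlt
    have hv' : ‖v‖ ≠ 0 := by positivity
    have hmem : ‖v‖⁻¹ • v ∈ Metric.sphere (0 : V) 1 := by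
      simp [norm_smul, hv']
    have h1 : m ≤ b (‖v‖⁻¹ • v) (‖v‖⁻¹ • v) := hmin hmem
    simp only [map_smul, smul_apply, smul_eq_mul] at h1
    have h2 : b v v < 1 := hv
    have h3 : m * ‖v‖ ^ 2 ≤ b v v := by
      have : m * ‖v‖ ^ 2 ≤ (‖v‖⁻¹ * (‖v‖⁻¹ * b v v)) * ‖v‖ ^ 2 := by gcongr
      calc _ ≤ _ := this
        _ = b v v := by field_simp
    have h4 : 1 < m * ‖v‖ := by
      have := mul_lt_mul_of_pos_left hv2 hmpos
      rwa [mul_inv_cancel₀ hmpos.ne'] at this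
    nlinarith

/-- The cone metric `dr² + r² g` as a family of bilinear forms. -/
def coneInner (g : Metric I M) (p : Cone M) :
    TangentSpace (I.prod 𝓘(ℝ)) p →L[ℝ] TangentSpace (I.prod 𝓘(ℝ)) p →L[ℝ] ℝ :=
  (dr I p).smulRight (dr I p) +
    radius p ^ 2 • (ContinuousLinearMap.precomp ℝ (dproj I p)).comp ((g.inner p.1).comp (dproj I p))

lemma coneInner_apply (g : Metric I M) (p : Cone M) (u v : TangentSpace (I.prod 𝓘(ℝ)) p) :
    coneInner g p u v =
      dr I p u * dr I p v + radius p ^ 2 * g.inner p.1 (dproj I p u) (dproj I p v) := rfl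

/-- If `X` is a smooth vector field on the cone then its projection is smooth along `C(M) → M`. -/
lemma contMDiffAt_dproj {X : VField (I.prod 𝓘(ℝ)) (Cone M)} {p : Cone M} (hX : SmoothAt X p) :
    ContMDiffAt (I.prod 𝓘(ℝ)) (I.prod 𝓘(ℝ, E)) ∞
      (fun q ↦ (TotalSpace.mk' E q.1 (dproj I q (X q)) : TangentBundle I M)) p := by
  have h := (contMDiff_fst (I := I) (J := 𝓘(ℝ)) (M := M) (N := HalfLine)
    (n := ∞)).contMDiff_tangentMap (m := ∞) (by simp)
  exact ContMDiffAt.comp p h.contMDiffAt hX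

lemma contMDiffAt_dr {X : VField (I.prod 𝓘(ℝ)) (Cone M)} {p : Cone M} (hX : SmoothAt X p) :
    ContMDiffAt (I.prod 𝓘(ℝ)) 𝓘(ℝ) ∞ (fun q ↦ dr I q (X q)) p := by
  have h := (contMDiff_radius (I := I) (M := M)).contMDiff_tangentMap (m := ∞) (by simp)
  have h2 := ContMDiffAt.comp p h.contMDiffAt hX
  refine (contMDiffAt_totalSpace.1 h2).2.congr_of_eventuallyEq (Eventually.of_forall fun q ↦ ?_)
  simp [dr, mvfderiv, tangentMap]
  rfl

lemma coneInner_pos (g : Metric I M) (p : Cone M) (u : TangentSpace (I.prod 𝓘(ℝ)) p)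
    (hu : u ≠ 0) : 0 < coneInner g p u u := by
  rw [coneInner_apply]
  have hr := radius_pos p
  by_cases h2 : dproj I p u = 0
  · have h1 : dr I p u ≠ 0 := fun h1 ↦ hu (eq_zero_of_dr_dproj h1 h2)
    have : 0 < dr I p u * dr I p u := mul_self_pos.2 h1
    simpa [h2] using this
  · have h4 := g.pos p.1 _ h2
    have h3 := mul_self_nonneg (dr I p u)
    have h5 := mul_pos (pow_pos hr 2) h4
    linarith

/-- The metric cone: the Riemannian metric `dr² + r² g` on `C(M)`. -/
def coneMetric (g : Metric I M) : Metric (I.prod 𝓘(ℝ)) (Cone M) where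
  inner := coneInner g
  symm p u v := by
    rw [coneInner_apply, coneInner_apply, g.symm, mul_comm (dr I p u)]
  pos := coneInner_pos g
  isVonNBounded p := isVonNBounded_of_posDef (V := E × ℝ) (coneInner g p) fun u hu ↦
    coneInner_pos g p u hu
  contMDiff p := by
    apply contMDiffAt_hom_of_apply
    intro X hX
    apply contMDiffAt_hom_of_apply (F := ℝ) (V := Bundle.Trivial (Cone M) ℝ)
    intro Y hY
    rw [contMDiffAt_section]
    change ContMDiffAt _ _ _ (fun q ↦ coneInner g q (X q) (Y q)) p
    simp only [coneInner_apply]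
    have h1 : ContMDiffAt (I.prod 𝓘(ℝ)) (I.prod 𝓘(ℝ)) ∞ (fun q ↦ TotalSpace.mk' ℝ
        (E := Bundle.Trivial M ℝ) q.1 (g.inner q.1 (dproj I q (X q)) (dproj I q (Y q)))) p := by
      apply ContMDiffAt.clm_bundle_apply₂ (F₁ := E) (F₂ := E)
      · exact ContMDiffAt.comp p g.contMDiff.contMDiffAt contMDiffAt_fst
      · exact contMDiffAt_dproj hX
      · exact contMDiffAt_dproj hY
    have h2 := (contMDiffAt_totalSpace.1 h1).2
    exact ((contMDiffAt_dr hX).mul (contMDiffAt_dr hY)).add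
      ((contMDiff_radius.contMDiffAt.pow 2).mul h2)

namespace ThreeForm

variable (T : ThreeForm I M)

lemma eval_sum_left {ι : Type*} (s : Finset ι) (x : M) (a : ι → TangentSpace I x)
    (v w : TangentSpace I x) : T.eval x (∑ i ∈ s, a i) v w = ∑ i ∈ s, T.eval x (a i) v w :=
  map_sum (AddMonoidHom.mk' (fun u ↦ T.eval x u v w) fun u u' ↦ T.eval_add_left x u u' v w) a s

lemma eval_sum_mid {ι : Type*} (s : Finset ι) (x : M) (a : ι → TangentSpace I x)
    (u w : TangentSpace I x) : T.eval x u (∑ i ∈ s, a i) w = ∑ i ∈ s, T.eval x u (a i) w :=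
  map_sum (AddMonoidHom.mk' (fun v ↦ T.eval x u v w) fun v v' ↦ T.eval_add_mid x u v v' w) a s

lemma eval_sum_right {ι : Type*} (s : Finset ι) (x : M) (a : ι → TangentSpace I x)
    (u v : TangentSpace I x) : T.eval x u v (∑ i ∈ s, a i) = ∑ i ∈ s, T.eval x u v (a i) :=
  map_sum (AddMonoidHom.mk' (fun w ↦ T.eval x u v w) fun w w' ↦ T.eval_add_right x u v w w') a s

end ThreeForm

/-- The 3-form `r² T` on the cone. -/
def coneTorsion (T : ThreeForm I M) : ThreeForm (I.prod 𝓘(ℝ)) (Cone M) where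
  form p := radius p ^ 2 • (T.form p.1).compContinuousLinearMap (dproj I p)
  smooth p X Y Z hX hY hZ := by
    let t := trivializationAt E (TangentSpace I : M → Type _) p.1
    have hp : p.1 ∈ t.baseSet := mem_baseSet_trivializationAt ..
    let b := Module.finBasis ℝ E
    let s : Fin (Module.finrank ℝ E) → VField I M := fun i ↦ t.localFrame b i
    have hs : ∀ i, SmoothAt (s i) p.1 := fun i ↦ contMDiffAt_localFrame_of_mem ∞ t b i hp
    let c : VField (I.prod 𝓘(ℝ)) (Cone M) → Fin (Module.finrank ℝ E) → Cone M → ℝ :=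
      fun X i q ↦ b.repr (t ⟨q.1, dproj I q (X q)⟩).2 i
    have hc : ∀ X, SmoothAt X p → ∀ i, ContMDiffAt (I.prod 𝓘(ℝ)) 𝓘(ℝ) ∞ (c X i) p := by
      intro X hX i
      have h1 := (contMDiffAt_totalSpace.1 (contMDiffAt_dproj hX)).2
      exact ((b.coord i).toContinuousLinearMap.contMDiff.contMDiffAt).comp p h1
    have hexp : ∀ X : VField (I.prod 𝓘(ℝ)) (Cone M), ∀ q : Cone M, q.1 ∈ t.baseSet →
        dproj I q (X q) = ∑ i, c X i q • s i q.1 := by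
      intro X q hq
      have h := t.eq_sum_localFrameCoeff_smul (I := I) (b := b)
        (s := extend E (dproj I q (X q))) hq
      simp only [extend_apply_self] at h
      rw [h]
      refine Finset.sum_congr rfl fun i _ ↦ ?_
      have h2 := t.localFrameCoeff_eq_coeff (I := I) (b := b) (i := i)
        (s := extend E (dproj I q (X q))) hq
      simp only [extend_apply_self] at h2
      rw [h2]
    have key : (fun q ↦ radius q ^ 2 * ∑ i, c X i q * ∑ j, c Y j q * ∑ k, c Z k q *
        T.eval q.1 (s i q.1) (s j q.1) (s k q.1)) =ᶠ[𝓝 p]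
        fun q ↦ (radius q ^ 2 • (T.form q.1).compContinuousLinearMap (dproj I q))
          ![X q, Y q, Z q] := by
      filter_upwards [continuous_fst.continuousAt.preimage_mem_nhds
        (t.open_baseSet.mem_nhds hp)] with q hq
      have h : (radius q ^ 2 • (T.form q.1).compContinuousLinearMap (dproj I q))
          ![X q, Y q, Z q] =
          radius q ^ 2 * T.eval q.1 (dproj I q (X q)) (dproj I q (Y q)) (dproj I q (Z q)) := by
        simp only [ContinuousAlternatingMap.smul_apply, smul_eq_mul,
          ContinuousAlternatingMap.compContinuousLinearMap_apply, ThreeForm.eval]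
        congr 2
        ext i
        fin_cases i <;> rfl
      rw [h, hexp X q hq, hexp Y q hq, hexp Z q hq]
      simp only [ThreeForm.eval_sum_left, ThreeForm.eval_smul_left]
      simp only [ThreeForm.eval_sum_mid, ThreeForm.eval_smul_mid]
      simp only [ThreeForm.eval_sum_right, ThreeForm.eval_smul_right]
    refine ContMDiffAt.congr_of_eventuallyEq ?_ key.symm
    refine (contMDiff_radius.contMDiffAt.pow 2).mul (ContMDiffAt.sum fun i _ ↦ (hc X hX i).mul
      (ContMDiffAt.sum fun j _ ↦ (hc Y hY j).mul (ContMDiffAt.sum fun k _ ↦ (hc Z hZ k).mul ?_)))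
    exact ContMDiffAt.comp p (T.smooth p.1 _ _ _ (hs i) (hs j) (hs k)) contMDiffAt_fst

lemma coneTorsion_eval (T : ThreeForm I M) (p : Cone M) (u v w : TangentSpace (I.prod 𝓘(ℝ)) p) :
    (coneTorsion T).eval p u v w =
      radius p ^ 2 * T.eval p.1 (dproj I p u) (dproj I p v) (dproj I p w) := by
  simp only [coneTorsion, ContinuousAlternatingMap.smul_apply, smul_eq_mul,
    ContinuousAlternatingMap.compContinuousLinearMap_apply, ThreeForm.eval]
  congr 2
  ext i
  fin_cases i <;> rfl


end Cone

section Structures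

variable {E : Type*} [NormedAddCommGroup E] [NormedSpace ℝ E] [FiniteDimensional ℝ E]
  {H : Type*} [TopologicalSpace H] {I : ModelWithCorners ℝ E H}
  {M : Type*} [TopologicalSpace M] [ChartedSpace H M] [IsManifold I ∞ M]

variable (g : Metric I M) (T : ThreeForm I M)

/-! ### Kähler with torsion structures -/

variable (I M) in
/-- A (not necessarily continuous) field of endomorphisms of the tangent spaces. -/
abbrev EndoField := Π x : M, TangentSpace I x →L[ℝ] TangentSpace I x

/-- The vector field `A(X)`. -/
def EndoField.app (A : EndoField I M) (X : VField I M) : VField I M := fun x ↦ A x (X x)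

/-- The vector field `∇^T_X Y`. -/
def nabla (X Y : VField I M) : VField I M := fun x ↦ torsionConnection g T Y x (X x)

/-- The vector field `(∇^T_X A)(Y) = ∇^T_X (A(Y)) - A(∇^T_X Y)`. -/
def nablaEndo (X : VField I M) (A : EndoField I M) (Y : VField I M) : VField I M :=
  nabla g T X (A.app Y) - A.app (nabla g T X Y)

/-- The Nijenhuis tensor `N_J(X, Y) = [JX, JY] - [X, Y] - J[X, JY] - J[JX, Y]`. -/
def nijenhuis (J : EndoField I M) (X Y : VField I M) : VField I M :=
  mlieBracket I (J.app X) (J.app Y) - mlieBracket I X Y - J.app (mlieBracket I X (J.app Y))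
    - J.app (mlieBracket I (J.app X) Y)

/-- `J` is a complex structure: a smooth almost complex structure which is integrable, i.e. whose
Nijenhuis tensor vanishes. -/
structure IsComplexStructure (J : EndoField I M) : Prop where
  contMDiff : ContMDiff I (I.prod 𝓘(ℝ, E →L[ℝ] E)) ∞
    (fun x ↦ TotalSpace.mk' (E →L[ℝ] E)
      (E := fun x : M ↦ TangentSpace I x →L[ℝ] TangentSpace I x) x (J x))
  sq (x : M) (u : TangentSpace I x) : J x (J x u) = -u
  integrable (X Y : VField I M) (hX : IsSmooth X) (hY : IsSmooth Y) : nijenhuis J X Y = 0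

/-- `(M, g, J)` is a Hermitian manifold. -/
structure IsHermitian (J : EndoField I M) : Prop extends IsComplexStructure J where
  hermitian (x : M) (u v : TangentSpace I x) : g.inner x (J x u) (J x v) = g.inner x u v

/-- `B` is the Bismut torsion of `(g, J)`: the connection `∇^B` with totally skew-symmetric
torsion `B` (which always satisfies `∇^B g = 0`) satisfies `∇^B J = 0`. -/
def IsBismutTorsion (J : EndoField I M) (B : ThreeForm I M) : Prop :=
  ∀ X Y : VField I M, IsSmooth X → IsSmooth Y → nablaEndo g B X J Y = 0

/-- `(M, g)` is Kähler with torsion, with Bismut torsion `B`. -/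
def IsKahlerWithTorsion (B : ThreeForm I M) : Prop :=
  ∃ J : EndoField I M, IsHermitian g J ∧ IsBismutTorsion g J B

/-- `(M, g, T)` is Sasaki with torsion: its metric cone `(M × ℝ₊, dr² + r² g)` is Kähler with
torsion, with Bismut torsion `r² T`. -/
def IsSasakiWithTorsion : Prop :=
  IsKahlerWithTorsion (coneMetric g) (coneTorsion T)

/-! ### The conditions on a unit Killing vector field -/

/-- `ξ` is a (smooth) Killing vector field of unit length; the Killing equation `𝓛_ξ g = 0` reads
`ξ(g(X, Y)) = g([ξ, X], Y) + g(X, [ξ, Y])`. -/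
structure IsUnitKilling (ξ : VField I M) : Prop where
  smooth : IsSmooth ξ
  killing (X Y : VField I M) (hX : IsSmooth X) (hY : IsSmooth Y) (x : M) :
    dirDeriv ξ (pair g X Y) x = pair g (mlieBracket I ξ X) Y x + pair g X (mlieBracket I ξ Y) x
  unit (x : M) : g.inner x (ξ x) (ξ x) = 1

/-- The function `(∇^T_X α)(Y) = X(α(Y)) - α(∇^T_X Y)` for a 1-form `α`, viewed as a
function-valued map on vector fields. -/
def nablaOneForm (X : VField I M) (α : VField I M → M → ℝ) (Y : VField I M) : M → ℝ :=
  dirDeriv X (α Y) - α (nabla g T X Y)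

/-- The function `(∇^T_X Ψ)(Y, Z) = X(Ψ(Y, Z)) - Ψ(∇^T_X Y, Z) - Ψ(Y, ∇^T_X Z)`
for a 2-form `Ψ`, viewed as a function-valued map on pairs of vector fields. -/
def nablaTwoForm (X : VField I M) (Ψ : VField I M → VField I M → M → ℝ) (Y Z : VField I M) :
    M → ℝ :=
  dirDeriv X (Ψ Y Z) - Ψ (nabla g T X Y) Z - Ψ Y (nabla g T X Z)

/-- `d^T α = ∑ₐ eᵃ ∧ ∇^T_{eₐ} α` for a 1-form `α`. Evaluated on vector fields, this is
`(d^T α)(X, Y) = (∇^T_X α)(Y) - (∇^T_Y α)(X)`. -/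
def dT (α : VField I M → M → ℝ) (X Y : VField I M) : M → ℝ :=
  nablaOneForm g T X α Y - nablaOneForm g T Y α X

/-- The tensor field `Φ(X) = ∇^T_X ξ`. -/
def Phi (ξ : VField I M) : EndoField I M := torsionConnection g T ξ

/-- The curvature `R^T(X, Y)Z = ∇^T_X ∇^T_Y Z - ∇^T_Y ∇^T_X Z - ∇^T_{[X, Y]} Z`. -/
def curvature (X Y Z : VField I M) : VField I M :=
  nabla g T X (nabla g T Y Z) - nabla g T Y (nabla g T X Z) - nabla g T (mlieBracket I X Y) Z

/-- Condition (a): `∇^T_X (d^T η) = -2 X^♭ ∧ η`, where `η = g(ξ, ·)`. -/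
def CondA (ξ : VField I M) : Prop :=
  ∀ X Y Z : VField I M, IsSmooth X → IsSmooth Y → IsSmooth Z → ∀ x : M,
    nablaTwoForm g T X (dT g T (pair g ξ)) Y Z x =
      -2 * (pair g X Y x * pair g ξ Z x - pair g X Z x * pair g ξ Y x)

/-- Condition (b): `(∇^T_X Φ)(Y) = g(ξ, Y) X - g(X, Y) ξ`. -/
def CondB (ξ : VField I M) : Prop :=
  ∀ X Y : VField I M, IsSmooth X → IsSmooth Y → ∀ x : M,
    nablaEndo g T X (Phi g T ξ) Y x = pair g ξ Y x • X x - pair g X Y x • ξ x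

/-- Condition (c): `R^T(X, Y)ξ = g(ξ, Y) X - g(ξ, X) Y + Φ(T(X, Y))`. -/
def CondC (ξ : VField I M) : Prop :=
  ∀ X Y : VField I M, IsSmooth X → IsSmooth Y → ∀ x : M,
    curvature g T X Y ξ x =
      pair g ξ Y x • X x - pair g ξ X x • Y x + Phi g T ξ x (torsionVec g T x (X x) (Y x))

/-- The compatibility identity
`T(X, Y, Z) = T(X, Φ(Y), Φ(Z)) + T(Φ(X), Y, Φ(Z)) + T(Φ(X), Φ(Y), Z)`. -/
def TorsionCompat (ξ : VField I M) : Prop :=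
  ∀ (x : M) (u v w : TangentSpace I x),
    T.eval x u v w = T.eval x u (Phi g T ξ x v) (Phi g T ξ x w)
      + T.eval x (Phi g T ξ x u) v (Phi g T ξ x w)
      + T.eval x (Phi g T ξ x u) (Phi g T ξ x v) w

end Structures
end
end SasakiTorsion

/-!
Let `ξ` be a unit Killing field. Then `Φ = ∇^T ξ` is skew-symmetric for `g`, whatever `T` is
(`IsUnitKilling.inner_Phi`), so `d^T η (X, Y) = 2 g(Φ X, Y)`, and (a) is twice the dual form of (b)
(`IsUnitKilling.condA_iff_condB`). The curvature `R^T(X, Y)ξ` is the antisymmetrization of `∇^T Φ`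
plus `Φ(T(X, Y))`. Hence (b) implies (c), and (c) says that the defect of (b), a trilinear form
which is skew-symmetric in its last two arguments, is symmetric in its first two; such a form is
zero (`IsUnitKilling.condB_iff_condC`).

It remains to compare (b) with the cone. On fields `Y + b ∂_r`, with `Y` a field on `M` and `b`
a constant, the connection of the cone with torsion `r² T` is explicit
(`torsionConnection_coneField`): its tangential part is `∇^T` with the usual conical corrections,
and its radial part is `-r g(X, Y)`.

Given `ξ` with (b), the endomorphism `J X = Φ X - r η(X) ∂_r`, `J (r ∂_r) = ξ` (`coneJ`) has
square `-1` and is orthogonal because `Φ² = -1 + η ⊗ ξ` (`IsUnitKilling.Phi_Phi`), and (b) is what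
makes it parallel (`torsionConnection_coneJ`). The Nijenhuis tensor of a parallel almost complex
structure is algebraic in `J` and the torsion (`nijenhuis_eq`). For a Hermitian `J` it vanishes if
and only if `B(X, Y, Z) = B(X, JY, JZ) + B(JX, Y, JZ) + B(JX, JY, Z)`. For `B = r² T` this is the
identity of the theorem on vectors tangent to `M`, which also implies it on all others
(`nijenhuis_coneJ`).

Conversely, a Kähler structure with torsion `r² T` on the cone yields the field `ξ = J ∂_r` along
`r = 1` (`reeb`). Along this hypersurface, `∇J = 0` says that `∇^T ξ` is the tangential part of `J`
(`Phi_reeb`), so `ξ` is Killing, and that (b) holds (`condB_reeb`); integrability gives the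
identity for `T` (`torsionCompat_reeb`).
-/

namespace SasakiTorsion

open Bundle Set Filter Topology FiberBundle VectorField

noncomputable section

set_option linter.unusedSectionVars false

/-! ### Smooth vector fields and Riemannian metrics -/

section Riemannian

variable {E : Type*} [NormedAddCommGroup E] [NormedSpace ℝ E]
  {H : Type*} [TopologicalSpace H] {I : ModelWithCorners ℝ E H}
  {M : Type*} [TopologicalSpace M] [ChartedSpace H M] [IsManifold I ∞ M]

namespace ThreeForm

variable (T : ThreeForm I M) (x : M) (u v w : TangentSpace I x)

lemma eval_swap_left : T.eval x v u w = -T.eval x u v w := by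
  have e : ![v, u, w] = ![u, v, w] ∘ Equiv.swap 0 1 := by
    ext i
    fin_cases i <;> rfl
  rw [eval, e]
  exact (T.form x).map_swap ![u, v, w] (i := 0) (j := 1) (by decide)

lemma eval_swap_right : T.eval x u w v = -T.eval x u v w := by
  have e : ![u, w, v] = ![u, v, w] ∘ Equiv.swap 1 2 := by
    ext i
    fin_cases i <;> rfl
  rw [eval, e]
  exact (T.form x).map_swap ![u, v, w] (i := 1) (j := 2) (by decide)

@[simp] lemma eval_self_left : T.eval x u u w = 0 := by
  have := T.eval_swap_left x u u w
  linarith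

@[simp] lemma eval_self_right : T.eval x u v v = 0 := by
  have := T.eval_swap_right x u v v
  linarith

@[simp] lemma eval_self_outer : T.eval x u v u = 0 := by
  rw [eval_swap_left, eval_self_right, neg_zero]

@[simp] lemma eval_zero_left : T.eval x 0 v w = 0 := by
  simpa using T.eval_smul_left x 0 0 v w

end ThreeForm

lemma isSmooth_zero : IsSmooth (0 : VField I M) :=
  fun x ↦ contMDiff_zeroSection ℝ (TangentSpace I : M → Type _) x

lemma IsSmooth.smoothAt {X : VField I M} (hX : IsSmooth X) (x : M) : SmoothAt X x :=
  hX.contMDiffAt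

lemma SmoothAt.mdifferentiableAt {X : VField I M} {x : M} (hX : SmoothAt X x) :
    MDiffAt (T% X) x :=
  ContMDiffAt.mdifferentiableAt hX (by simp)

/-- Only differentiability persists near `x`: the order of smoothness of a `C^∞` germ may depend
on the neighbourhood. -/
lemma SmoothAt.eventually {X : VField I M} {x : M} (hX : SmoothAt X x) :
    ∀ᶠ y in 𝓝 x, MDiffAt (T% X) y := by
  have h1 : CMDiffAt 1 (T% X) x := ContMDiffAt.of_le hX (by simp)
  filter_upwards [(contMDiffAt_iff_contMDiffAt_nhds (by simp)).1 h1] with y hy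
  exact hy.mdifferentiableAt (by simp)

lemma eventually_mdifferentiableAt {f : M → ℝ} {x : M} (hf : ContMDiffAt I 𝓘(ℝ) ∞ f x) :
    ∀ᶠ y in 𝓝 x, MDiffAt f y := by
  have h1 : CMDiffAt 1 f x := hf.of_le (by simp)
  filter_upwards [(contMDiffAt_iff_contMDiffAt_nhds (by simp)).1 h1] with y hy
  exact hy.mdifferentiableAt (by simp)

lemma smoothAt_extend [FiniteDimensional ℝ E] {x : M} (u : TangentSpace I x) :
    SmoothAt (extend E u) x :=
  contMDiffAt_extend I E u

lemma SmoothAt.add {X Y : VField I M} {x : M} (hX : SmoothAt X x) (hY : SmoothAt Y x) :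
    SmoothAt (X + Y) x :=
  ContMDiffAt.add_section hX hY

lemma SmoothAt.smul {f : M → ℝ} {X : VField I M} {x : M}
    (hf : ContMDiffAt I 𝓘(ℝ) ∞ f x) (hX : SmoothAt X x) : SmoothAt (f • X) x :=
  ContMDiffAt.smul_section hf hX

lemma SmoothAt.mlieBracket [CompleteSpace E] {X Y : VField I M} {x : M} (hX : SmoothAt X x)
    (hY : SmoothAt Y x) : SmoothAt (mlieBracket I X Y) x := by
  have : IsManifold I ((⊤ : ℕ∞) + 1) M := by simpa
  have : IsManifold I (minSmoothness ℝ 2) M := by simpa using (inferInstance : IsManifold I 2 M)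
  exact ContMDiffAt.mlieBracket_vectorField (m := ⊤) (n := ⊤) hX hY (by simp)

lemma contMDiffAt_dirDeriv {X : VField I M} {f : M → ℝ} {x : M} (hX : SmoothAt X x)
    (hf : ContMDiffAt I 𝓘(ℝ) ∞ f x) : ContMDiffAt I 𝓘(ℝ) ∞ (dirDeriv X f) x := by
  have h1 := hf.mfderiv_const (m := ∞) (by simp)
  have h2 := ContMDiffAt.clm_apply_of_inCoordinates (b₁ := id) h1 hX hf
  refine (contMDiffAt_totalSpace.1 h2).2.congr_of_eventuallyEq (Eventually.of_forall fun q ↦ ?_)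
  simp [dirDeriv, mvfderiv]
  rfl

variable {g : Metric I M}

lemma contMDiffAt_pair {X Y : VField I M} {x : M} (hX : SmoothAt X x) (hY : SmoothAt Y x) :
    ContMDiffAt I 𝓘(ℝ) ∞ (pair g X Y) x := by
  have h : ContMDiffAt I (I.prod 𝓘(ℝ)) ∞ (fun y ↦ TotalSpace.mk' ℝ
      (E := Bundle.Trivial M ℝ) y (g.inner y (X y) (Y y))) x := by
    apply ContMDiffAt.clm_bundle_apply₂ (F₁ := E) (F₂ := E)
    · exact g.contMDiff.contMDiffAt
    · exact hX
    · exact hY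
  exact (contMDiffAt_totalSpace.1 h).2

lemma pair_comm (X Y : VField I M) : pair g X Y = pair g Y X :=
  funext fun x ↦ g.symm x _ _

lemma eq_of_inner_eq {x : M} {v v' : TangentSpace I x}
    (h : ∀ w, g.inner x v w = g.inner x v' w) : v = v' := by
  by_contra hne
  have h1 := g.pos x (v - v') (sub_ne_zero.2 hne)
  simp [h] at h1

/-- The action of the Lie bracket on functions: `[X, Y] f = X (Y f) - Y (X f)`. It follows from
the Leibniz rule for `[X, f Z]` and the Jacobi identity for `X`, `Y`, `f Z`. -/
lemma dirDeriv_mlieBracket [FiniteDimensional ℝ E] {X Y : VField I M} {f : M → ℝ} {x : M}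
    (hX : SmoothAt X x) (hY : SmoothAt Y x) (hf : ContMDiffAt I 𝓘(ℝ) ∞ f x) :
    dirDeriv (mlieBracket I X Y) f x = dirDeriv X (dirDeriv Y f) x - dirDeriv Y (dirDeriv X f) x := by
  have := FiniteDimensional.complete ℝ E
  rcases subsingleton_or_nontrivial E with hE | hE
  · have h0 : ∀ (Z : VField I M) (f : M → ℝ), dirDeriv Z f = 0 := by
      intro Z f
      ext y
      have : Z y = 0 := Subsingleton.elim (α := E) _ _
      simp [dirDeriv, this]
    simp [h0]
  obtain ⟨v, hv⟩ := exists_ne (0 : E)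
  let Z : VField I M := extend E (x := x) (show TangentSpace I x from v)
  have hZ : SmoothAt Z x := smoothAt_extend _
  have hZx : Z x ≠ 0 := by
    have e : Z x = v := extend_apply_self E (E := TangentSpace I) (x := x) v
    rw [e]
    exact hv
  have : IsManifold I (minSmoothness ℝ 3) M := by simpa using (inferInstance : IsManifold I 3 M)
  have : IsManifold I (minSmoothness ℝ 2) M := by simpa using (inferInstance : IsManifold I 2 M)
  have h2 : ∀ {Z : VField I M}, SmoothAt Z x → CMDiffAt (minSmoothness ℝ 2) (T% Z) x := by
    intro Z hZ
    refine ContMDiffAt.of_le hZ ?_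
    rw [minSmoothness_of_isRCLikeNormedField]
    exact ENat.LEInfty.out
  have hfd := ContMDiffAt.mdifferentiableAt hf (by simp)
  have hJ := leibniz_identity_mlieBracket_apply (h2 hX) (h2 hY) (h2 hZ)
  have hJf := leibniz_identity_mlieBracket_apply (h2 hX) (h2 hY) (h2 (hZ.smul hf))
  -- The Leibniz rule holds near `x`, as both vector fields and the function are smooth there.
  have key : ∀ {A : VField I M}, SmoothAt A x → mlieBracket I A (f • Z) =ᶠ[𝓝 x]
      ((dirDeriv A f) • Z + f • mlieBracket I A Z : VField I M) := by
    intro A hA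
    filter_upwards [hZ.eventually, eventually_mdifferentiableAt hf] with y hZy hfy
    rw [mlieBracket_smul_right hfy hZy]
    rfl
  have key2 : ∀ {A B : VField I M}, SmoothAt A x → SmoothAt B x →
      mlieBracket I A (mlieBracket I B (f • Z)) x =
        (dirDeriv A (dirDeriv B f) x • Z x + dirDeriv B f x • mlieBracket I A Z x) +
        (dirDeriv A f x • mlieBracket I B Z x + f x • mlieBracket I A (mlieBracket I B Z) x) := by
    intro A B hA hB
    rw [Filter.EventuallyEq.mlieBracket_vectorField_eq (EventuallyEq.refl _ A) (key hB)]
    have hBf := contMDiffAt_dirDeriv hB hf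
    have hBZ := hB.mlieBracket hZ
    rw [mlieBracket_add_right (hZ.smul hBf).mdifferentiableAt (hBZ.smul hf).mdifferentiableAt,
      mlieBracket_smul_right (hBf.mdifferentiableAt (by simp)) hZ.mdifferentiableAt,
      mlieBracket_smul_right hfd hBZ.mdifferentiableAt]
    rfl
  rw [key2 hX hY, key2 hY hX, (key (hX.mlieBracket hY)).self_of_nhds] at hJf
  have hfin : (dirDeriv (mlieBracket I X Y) f x
      - (dirDeriv X (dirDeriv Y f) x - dirDeriv Y (dirDeriv X f) x)) • Z x = 0 := by
    simp only [Pi.add_apply, Pi.smul_apply', hJ, smul_add] at hJf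
    have := sub_eq_zero.2 hJf
    rw [← neg_eq_zero, ← this]
    module
  rcases smul_eq_zero.1 hfin with h | h
  · linarith
  · exact absurd h hZx

variable [FiniteDimensional ℝ E]

lemma contMDiffAt_matrix_det {ι : Type*} [Fintype ι] [DecidableEq ι] {A : M → Matrix ι ι ℝ} {x : M}
    (hA : ∀ i j, ContMDiffAt I 𝓘(ℝ) ∞ (fun y ↦ A y i j) x) :
    ContMDiffAt I 𝓘(ℝ) ∞ (fun y ↦ (A y).det) x := by
  simp only [Matrix.det_apply, Units.smul_def, zsmul_eq_mul]
  exact ContMDiffAt.sum fun σ _ ↦ contMDiffAt_const.mul (ContMDiffAt.prod fun i _ ↦ hA _ _)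

/-- A vector field is smooth as soon as its inner products with smooth vector fields are smooth:
in a local frame its coefficients are obtained from these functions by Cramer's rule for the Gram
matrix. -/
lemma smoothAt_of_pair (g : Metric I M) {V : VField I M} {x : M}
    (h : ∀ Z : VField I M, SmoothAt Z x → ContMDiffAt I 𝓘(ℝ) ∞ (pair g V Z) x) : SmoothAt V x := by
  classical
  let t := trivializationAt E (TangentSpace I : M → Type _) x
  have hx : x ∈ t.baseSet := mem_baseSet_trivializationAt ..
  let b := Module.finBasis ℝ E
  let s : Fin (Module.finrank ℝ E) → VField I M := fun i ↦ t.localFrame b i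
  have hs : ∀ i, SmoothAt (s i) x := fun i ↦ contMDiffAt_localFrame_of_mem ∞ t b i hx
  refine (contMDiffAt_iff_localFrameCoeff (I := I) (e := t) b hx).2 fun i ↦ ?_
  let c : Fin (Module.finrank ℝ E) → M → ℝ := fun i y ↦ t.localFrameCoeff I b i y (V y)
  let G : M → Matrix (Fin (Module.finrank ℝ E)) (Fin (Module.finrank ℝ E)) ℝ :=
    fun y ↦ Matrix.of fun i j ↦ pair g (s i) (s j) y
  have hG : ∀ i j, ContMDiffAt I 𝓘(ℝ) ∞ (fun y ↦ G y i j) x := fun i j ↦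
    contMDiffAt_pair (hs i) (hs j)
  have hadj : ∀ i j, ContMDiffAt I 𝓘(ℝ) ∞ (fun y ↦ (G y).adjugate i j) x := by
    intro i j
    simp only [Matrix.adjugate_apply]
    refine contMDiffAt_matrix_det fun k l ↦ ?_
    simp only [Matrix.updateRow_apply]
    split_ifs
    · exact contMDiffAt_const
    · exact hG k l
  have hdet : ∀ᶠ y in 𝓝 x, (G y).det ≠ 0 := by
    filter_upwards [t.open_baseSet.mem_nhds hx] with y hy h0
    obtain ⟨a, ha, ha0⟩ := Matrix.exists_mulVec_eq_zero_iff.2 h0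
    let w : TangentSpace I y := ∑ j, a j • s j y
    have hw : w ≠ 0 := by
      intro hw
      apply ha
      have hli := (t.basisAt b hy).linearIndependent
      rw [Fintype.linearIndependent_iff] at hli
      refine funext (hli a ?_)
      simpa [w, s, hy] using hw
    have h1 := g.pos y w hw
    have h2 : ∀ i, g.inner y (s i y) w = 0 := by
      intro i
      have := congrFun ha0 i
      simp only [Matrix.mulVec, dotProduct, G, Matrix.of_apply, pair, Pi.zero_apply] at this
      simpa [w, mul_comm] using this
    have h3 : ∀ z, g.inner y w z = ∑ i, a i * g.inner y (s i y) z := by simp [w]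
    simp [h3, h2] at h1
  have hsmooth : ContMDiffAt I 𝓘(ℝ) ∞
      (fun y ↦ (G y).det⁻¹ * ∑ j, (G y).adjugate i j * pair g V (s j) y) x :=
    ((contMDiffAt_matrix_det hG).inv₀ hdet.self_of_nhds).mul
      (ContMDiffAt.sum fun j _ ↦ (hadj i j).mul (h _ (hs j)))
  refine hsmooth.congr_of_eventuallyEq ?_
  filter_upwards [t.eventually_eq_localFrame_sum_coeff_smul (I := I) (s := V) b hx, hdet] with y hy hd
  have h1 : (fun j ↦ pair g V (s j) y) = (G y).mulVec (fun k ↦ c k y) := by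
    ext j
    simp only [Matrix.mulVec, dotProduct, G, Matrix.of_apply, pair]
    rw [g.symm y (V y), hy]
    simp only [map_sum, map_smul, smul_eq_mul]
    exact Finset.sum_congr rfl fun k _ ↦ mul_comm _ _
  have h2 := congrArg (fun v ↦ ((G y).adjugate.mulVec v) i) h1
  simp only [Matrix.mulVec_mulVec, Matrix.adjugate_mul, Matrix.smul_mulVec, Matrix.one_mulVec] at h2
  change c i y = _
  have h3 : ∑ j, (G y).adjugate i j * pair g V (s j) y = (G y).det * c i y := h2
  rw [h3, inv_mul_cancel_left₀ hd]

end Riemannian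

/-! ### The metric connection with skew-symmetric torsion -/

section Connection

variable {E : Type*} [NormedAddCommGroup E] [NormedSpace ℝ E] [FiniteDimensional ℝ E]
  {H : Type*} [TopologicalSpace H] {I : ModelWithCorners ℝ E H}
  {M : Type*} [TopologicalSpace M] [ChartedSpace H M] [IsManifold I ∞ M]

lemma exists_isSmooth_eq [T2Space M] {x : M} (u : TangentSpace I x) :
    ∃ X : VField I M, IsSmooth X ∧ X x = u := by
  obtain ⟨s, hs, hsu⟩ := exists_contMDiffOn_extend (k := ∞) I E u
  obtain ⟨U, hUs, hU, hxU⟩ := mem_nhds_iff.1 hs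
  obtain ⟨f, -, hf⟩ := (SmoothBumpFunction.nhds_basis_tsupport (I := I) x).mem_iff.1
    (hU.mem_nhds hxU)
  refine ⟨(f : M → ℝ) • (extend E u : VField I M), ContMDiffOn.smul_section_of_tsupport
    f.contMDiff.contMDiffOn hU hf (hsu.mono hUs), ?_⟩
  have e : extend E u x = u := extend_apply_self E u
  rw [Pi.smul_apply', e, f.eq_one, one_smul]

variable {g : Metric I M} {T : ThreeForm I M}

lemma inner_torsionConnection_eq_koszul {X Y Z : VField I M} {x : M} (hX : MDiffAt (T% X) x)
    (hY : MDiffAt (T% Y) x) (hZ : MDiffAt (T% Z) x) :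
    g.inner x (torsionConnection g T Y x (X x)) (Z x) =
      koszul g X Y Z x + 1 / 2 * T.eval x (X x) (Y x) (Z x) := by
  rw [inner_torsionConnection, inner_leviCivita g hX hY hZ]

/-- The connection `∇^T` is metric. -/
lemma mvfderiv_pair {Y Z : VField I M} {x : M} (hY : MDiffAt (T% Y) x) (hZ : MDiffAt (T% Z) x)
    (T : ThreeForm I M) (u : TangentSpace I x) :
    mvfderiv I (pair g Y Z) x u = g.inner x (torsionConnection g T Y x u) (Z x) +
      g.inner x (Y x) (torsionConnection g T Z x u) := by
  obtain ⟨X, hX, rfl⟩ : ∃ X : VField I M, MDiffAt (T% X) x ∧ X x = u :=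
    ⟨extend E u, mdifferentiableAt_extend .., extend_apply_self E u⟩
  rw [g.symm x (Y x), inner_torsionConnection_eq_koszul hX hY hZ,
    inner_torsionConnection_eq_koszul hX hZ hY, T.eval_swap_right x _ (Y x)]
  simp only [koszul, dirDeriv, pair_comm Z Y, pair_comm X Y]
  have h : pair g (mlieBracket I Z Y) X x = -pair g (mlieBracket I Y Z) X x := by
    simp only [pair]
    rw [mlieBracket_swap_apply]
    simp
  rw [h]
  ring

/-- The connection `∇^T` has torsion `T`. -/
lemma mlieBracket_eq {X Y : VField I M} {x : M} (hX : MDiffAt (T% X) x) (hY : MDiffAt (T% Y) x)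
    (g : Metric I M) (T : ThreeForm I M) :
    mlieBracket I X Y x = torsionConnection g T Y x (X x) - torsionConnection g T X x (Y x)
      - torsionVec g T x (X x) (Y x) := by
  apply eq_of_inner_eq (g := g)
  intro w
  obtain ⟨Z, hZ, rfl⟩ : ∃ Z : VField I M, MDiffAt (T% Z) x ∧ Z x = w :=
    ⟨extend E w, mdifferentiableAt_extend .., extend_apply_self E w⟩
  simp only [map_sub, sub_apply]
  rw [inner_torsionConnection_eq_koszul hX hY hZ,
    inner_torsionConnection_eq_koszul hY hX hZ, inner_torsionVec, T.eval_swap_left x (X x) (Y x)]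
  have h : pair g (mlieBracket I Y X) Z x = -pair g (mlieBracket I X Y) Z x := by
    simp only [pair]
    rw [mlieBracket_swap_apply]
    simp
  simp only [koszul, dirDeriv, pair_comm Y X, h]
  simp only [pair]
  ring

lemma contMDiffAt_koszul {X Y Z : VField I M} {x : M} (hX : SmoothAt X x) (hY : SmoothAt Y x)
    (hZ : SmoothAt Z x) : ContMDiffAt I 𝓘(ℝ) ∞ (koszul g X Y Z) x := by
  have := FiniteDimensional.complete ℝ E
  have hp : ∀ {A B C : VField I M}, SmoothAt A x → SmoothAt B x → SmoothAt C x →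
      ContMDiffAt I 𝓘(ℝ) ∞ (dirDeriv A (pair g B C)) x := fun hA hB hC ↦
    contMDiffAt_dirDeriv hA (contMDiffAt_pair hB hC)
  have hb : ∀ {A B C : VField I M}, SmoothAt A x → SmoothAt B x → SmoothAt C x →
      ContMDiffAt I 𝓘(ℝ) ∞ (pair g (mlieBracket I A B) C) x := fun hA hB hC ↦
    contMDiffAt_pair (hA.mlieBracket hB) hC
  exact contMDiffAt_const.mul ((((((hp hX hY hZ).add (hp hY hX hZ)).sub (hp hZ hX hY)).add
    (hb hX hY hZ)).sub (hb hX hZ hY)).sub (hb hY hZ hX))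

/-- If `X` and `Y` are smooth then so is `∇^T_X Y`. -/
lemma SmoothAt.nabla {X Y : VField I M} {x : M} (hX : SmoothAt X x) (hY : SmoothAt Y x)
    (g : Metric I M) (T : ThreeForm I M) : SmoothAt (nabla g T X Y) x := by
  apply smoothAt_of_pair g
  intro Z hZ
  refine ((contMDiffAt_koszul (g := g) hX hY hZ).add
    ((contMDiffAt_const (c := (1 / 2 : ℝ))).mul (T.smooth x X Y Z hX hY hZ))).congr_of_eventuallyEq ?_
  filter_upwards [hX.eventually, hY.eventually, hZ.eventually] with y hXy hYy hZy
  exact inner_torsionConnection_eq_koszul hXy hYy hZy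

lemma IsSmooth.nabla {X Y : VField I M} (hX : IsSmooth X) (hY : IsSmooth Y)
    (g : Metric I M) (T : ThreeForm I M) : IsSmooth (nabla g T X Y) :=
  fun x ↦ (hX.smoothAt x).nabla (hY.smoothAt x) g T

lemma torsionConnection_add {X Y : VField I M} {x : M} (hX : MDiffAt (T% X) x)
    (hY : MDiffAt (T% Y) x) (u : TangentSpace I x) :
    torsionConnection g T (X + Y) x u =
      torsionConnection g T X x u + torsionConnection g T Y x u := by
  rw [(torsionConnection g T).isCovariantDerivativeOnUniv.add hX hY]
  rfl

lemma torsionConnection_smul {f : M → ℝ} {X : VField I M} {x : M} (hf : MDiffAt f x)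
    (hX : MDiffAt (T% X) x) (u : TangentSpace I x) :
    torsionConnection g T (f • X) x u =
      f x • torsionConnection g T X x u + mvfderiv I f x u • X x := by
  rw [(torsionConnection g T).isCovariantDerivativeOnUniv.leibniz hX hf]
  rfl

/-- The operation `Y ↦ (∇^T_u J) Y` is tensorial. -/
lemma tensorialAt_nablaEndo {J : EndoField I M} {x : M}
    (hJ : ∀ Y : VField I M, MDiffAt (T% Y) x → MDiffAt (T% (J.app Y)) x) (u : TangentSpace I x) :
    TensorialAt I E (fun Y : VField I M ↦ torsionConnection g T (J.app Y) x u
      - J x (torsionConnection g T Y x u)) x where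
  smul {f Y} hf hY := by
    have e : J.app (f • Y) = f • J.app Y := by
      ext y
      simp [EndoField.app]
    rw [e, torsionConnection_smul hf (hJ Y hY), torsionConnection_smul hf hY]
    simp only [map_add, map_smul, EndoField.app]
    module
  add {Y Y'} hY hY' := by
    have e : J.app (Y + Y') = J.app Y + J.app Y' := by
      ext y
      simp [EndoField.app]
    rw [e, torsionConnection_add (hJ Y hY) (hJ Y' hY'), torsionConnection_add hY hY', map_add]
    module

/-- If `J` is an almost complex structure with `∇^T J = 0`, its Nijenhuis tensor is an algebraic
expression in `J` and `T`. -/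
lemma nijenhuis_eq {J : EndoField I M} {X Y : VField I M} {x : M}
    (hsq : ∀ u, J x (J x u) = -u)
    (hX : MDiffAt (T% X) x) (hY : MDiffAt (T% Y) x)
    (hJX : MDiffAt (T% (J.app X)) x) (hJY : MDiffAt (T% (J.app Y)) x)
    (hX' : ∀ u, torsionConnection g T (J.app X) x u = J x (torsionConnection g T X x u))
    (hY' : ∀ u, torsionConnection g T (J.app Y) x u = J x (torsionConnection g T Y x u)) :
    nijenhuis J X Y x = torsionVec g T x (X x) (Y x) - torsionVec g T x (J x (X x)) (J x (Y x))
      + J x (torsionVec g T x (X x) (J x (Y x))) + J x (torsionVec g T x (J x (X x)) (Y x)) := by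
  simp only [nijenhuis, Pi.sub_apply]
  rw [mlieBracket_eq hJX hJY g T, mlieBracket_eq hX hY g T]
  simp only [EndoField.app]
  rw [mlieBracket_eq hX hJY g T, mlieBracket_eq hJX hY g T]
  simp only [hX', hY', map_sub, hsq, EndoField.app]
  module

lemma _root_.ContMDiff.smoothAt_endoField_app {J : EndoField I M}
    (hJ : ContMDiff I (I.prod 𝓘(ℝ, E →L[ℝ] E)) ∞ (fun x ↦ TotalSpace.mk' (E →L[ℝ] E)
      (E := fun x : M ↦ TangentSpace I x →L[ℝ] TangentSpace I x) x (J x)))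
    {X : VField I M} {x : M} (hX : SmoothAt X x) : SmoothAt (J.app X) x :=
  ContMDiffAt.clm_bundle_apply hJ.contMDiffAt hX

lemma _root_.ContMDiff.mdifferentiableAt_endoField_app {J : EndoField I M}
    (hJ : ContMDiff I (I.prod 𝓘(ℝ, E →L[ℝ] E)) ∞ (fun x ↦ TotalSpace.mk' (E →L[ℝ] E)
      (E := fun x : M ↦ TangentSpace I x →L[ℝ] TangentSpace I x) x (J x)))
    {X : VField I M} {x : M} (hX : MDiffAt (T% X) x) : MDiffAt (T% (J.app X)) x :=
  MDifferentiableAt.clm_bundle_apply (hJ.contMDiffAt.mdifferentiableAt (by simp)) hX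

end Connection

/-! ### Unit Killing fields and the conditions (a), (b), (c) -/

section UnitKilling

variable {E : Type*} [NormedAddCommGroup E] [NormedSpace ℝ E] [FiniteDimensional ℝ E]
  {H : Type*} [TopologicalSpace H] {I : ModelWithCorners ℝ E H}
  {M : Type*} [TopologicalSpace M] [T2Space M] [ChartedSpace H M] [IsManifold I ∞ M]
  {g : Metric I M} {T : ThreeForm I M} {ξ : VField I M}

/-- The Killing equation for `ξ` says that `Φ = ∇^T ξ` is skew-symmetric, for any torsion `T`. -/
lemma dirDeriv_pair_eq_iff {X Y : VField I M} {x : M} (hξ : MDiffAt (T% ξ) x)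
    (hX : MDiffAt (T% X) x) (hY : MDiffAt (T% Y) x) :
    dirDeriv ξ (pair g X Y) x = pair g (mlieBracket I ξ X) Y x + pair g X (mlieBracket I ξ Y) x ↔
      g.inner x (Phi g T ξ x (X x)) (Y x) = -g.inner x (X x) (Phi g T ξ x (Y x)) := by
  simp only [dirDeriv, pair, Phi]
  rw [mlieBracket_eq hξ hX g T, mlieBracket_eq hξ hY g T]
  rw [mvfderiv_pair hX hY T]
  simp only [map_sub, sub_apply, g.symm x (X x) (torsionVec _ _ _ _ _), inner_torsionVec]
  rw [T.eval_swap_right x (ξ x) (X x) (Y x)]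
  constructor <;> intro h <;> linarith

lemma IsUnitKilling.inner_Phi (h : IsUnitKilling g ξ) (T : ThreeForm I M) (x : M)
    (u v : TangentSpace I x) :
    g.inner x (Phi g T ξ x u) v = -g.inner x u (Phi g T ξ x v) := by
  obtain ⟨X, hX, rfl⟩ := exists_isSmooth_eq u
  obtain ⟨Y, hY, rfl⟩ := exists_isSmooth_eq v
  exact (dirDeriv_pair_eq_iff (h.smooth.smoothAt x).mdifferentiableAt
    (hX.smoothAt x).mdifferentiableAt (hY.smoothAt x).mdifferentiableAt).1 (h.killing X Y hX hY x)

lemma isUnitKilling_of_inner_Phi (hξ : IsSmooth ξ) (hunit : ∀ x, g.inner x (ξ x) (ξ x) = 1)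
    (T : ThreeForm I M) (h : ∀ (x : M) (u v : TangentSpace I x),
      g.inner x (Phi g T ξ x u) v = -g.inner x u (Phi g T ξ x v)) : IsUnitKilling g ξ where
  smooth := hξ
  unit := hunit
  killing _ _ hX hY x := (dirDeriv_pair_eq_iff (hξ.smoothAt x).mdifferentiableAt
    (hX.smoothAt x).mdifferentiableAt (hY.smoothAt x).mdifferentiableAt).2 (h x _ _)

lemma IsUnitKilling.inner_Phi_self (h : IsUnitKilling g ξ) (T : ThreeForm I M) (x : M)
    (u : TangentSpace I x) : g.inner x (Phi g T ξ x u) (ξ x) = 0 := by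
  have h1 : pair g ξ ξ = fun _ ↦ (1 : ℝ) := funext h.unit
  have hd := (h.smooth.smoothAt x).mdifferentiableAt
  have h2 := mvfderiv_pair (g := g) hd hd T u
  rw [h1, mvfderiv_const, g.symm x (ξ x)] at h2
  simp only [zero_apply] at h2
  simp only [Phi]
  linarith

lemma IsUnitKilling.Phi_self (h : IsUnitKilling g ξ) (T : ThreeForm I M) (x : M) :
    Phi g T ξ x (ξ x) = 0 := by
  apply eq_of_inner_eq (g := g)
  intro w
  rw [h.inner_Phi, g.symm, h.inner_Phi_self]
  simp

lemma IsUnitKilling.isSmooth_app_Phi (h : IsUnitKilling g ξ) (T : ThreeForm I M)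
    {X : VField I M} (hX : IsSmooth X) : IsSmooth ((Phi g T ξ).app X) :=
  hX.nabla h.smooth g T

/-- For a Killing field `ξ` with dual form `η`, `d^T η (X, Y) = 2 g(Φ(X), Y)`. -/
lemma IsUnitKilling.dT_pair (h : IsUnitKilling g ξ) {X Y : VField I M} (hX : IsSmooth X)
    (hY : IsSmooth Y) :
    dT g T (pair g ξ) X Y = fun x ↦ 2 * pair g ((Phi g T ξ).app X) Y x := by
  ext x
  have hd := (h.smooth.smoothAt x).mdifferentiableAt
  simp only [dT, nablaOneForm, dirDeriv, Pi.sub_apply]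
  rw [mvfderiv_pair hd (hY.smoothAt x).mdifferentiableAt T,
    mvfderiv_pair hd (hX.smoothAt x).mdifferentiableAt T]
  have h1 := h.inner_Phi T x (X x) (Y x)
  rw [g.symm x (X x)] at h1
  simp only [Phi] at h1
  simp only [pair, nabla, EndoField.app, Phi]
  linarith

/-- `g((∇^T_X Φ) Y, Z)` in terms of the functions `g(Φ(Y), Z)`. -/
lemma IsUnitKilling.inner_nablaEndo_Phi (h : IsUnitKilling g ξ) {X Y Z : VField I M}
    (hY : IsSmooth Y) (hZ : IsSmooth Z) (x : M) :
    g.inner x (nablaEndo g T X (Phi g T ξ) Y x) (Z x) =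
      dirDeriv X (pair g ((Phi g T ξ).app Y) Z) x
      - pair g ((Phi g T ξ).app (nabla g T X Y)) Z x
      - pair g ((Phi g T ξ).app Y) (nabla g T X Z) x := by
  simp only [dirDeriv]
  rw [mvfderiv_pair ((h.isSmooth_app_Phi T hY).smoothAt x).mdifferentiableAt
    (hZ.smoothAt x).mdifferentiableAt T]
  simp only [nablaEndo, Pi.sub_apply, map_sub, sub_apply, pair, nabla]
  ring

lemma IsUnitKilling.nablaTwoForm_dT (h : IsUnitKilling g ξ) {X Y Z : VField I M} (hX : IsSmooth X)
    (hY : IsSmooth Y) (hZ : IsSmooth Z) (x : M) :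
    nablaTwoForm g T X (dT g T (pair g ξ)) Y Z x =
      2 * g.inner x (nablaEndo g T X (Phi g T ξ) Y x) (Z x) := by
  simp only [nablaTwoForm, Pi.sub_apply]
  rw [h.dT_pair hY hZ, h.dT_pair (hX.nabla hY g T) hZ, h.dT_pair hY (hX.nabla hZ g T),
    h.inner_nablaEndo_Phi hY hZ]
  have hd : MDiffAt (pair g ((Phi g T ξ).app Y) Z) x :=
    mdifferentiableAt_pair ((h.isSmooth_app_Phi T hY).smoothAt x).mdifferentiableAt
      (hZ.smoothAt x).mdifferentiableAt
  simp only [dirDeriv]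
  rw [mvfderiv_fun_mul mdifferentiableAt_const hd, mvfderiv_const]
  simp
  ring

lemma IsUnitKilling.condA_iff_condB (h : IsUnitKilling g ξ) : CondA g T ξ ↔ CondB g T ξ := by
  constructor
  · intro hA X Y hX hY x
    apply eq_of_inner_eq (g := g)
    intro w
    obtain ⟨Z, hZ, rfl⟩ := exists_isSmooth_eq w
    have := hA X Y Z hX hY hZ x
    rw [h.nablaTwoForm_dT hX hY hZ] at this
    simp only [pair, map_sub, map_smul, sub_apply, smul_apply, smul_eq_mul] at this ⊢
    linarith
  · intro hB X Y Z hX hY hZ x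
    rw [h.nablaTwoForm_dT hX hY hZ, hB X Y hX hY x]
    simp only [pair, map_sub, map_smul, sub_apply, smul_apply, smul_eq_mul]
    ring

/-- `∇^T_X Φ` is skew-symmetric. -/
lemma IsUnitKilling.inner_nablaEndo_Phi_comm (h : IsUnitKilling g ξ) {X Y Z : VField I M}
    (hY : IsSmooth Y) (hZ : IsSmooth Z) (x : M) :
    g.inner x (nablaEndo g T X (Phi g T ξ) Y x) (Z x) =
      -g.inner x (nablaEndo g T X (Phi g T ξ) Z x) (Y x) := by
  have hskew : ∀ A B : VField I M,
      pair g ((Phi g T ξ).app A) B = fun y ↦ -pair g ((Phi g T ξ).app B) A y := by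
    intro A B
    ext y
    simp only [pair, EndoField.app]
    rw [h.inner_Phi, g.symm]
  rw [h.inner_nablaEndo_Phi hY hZ, h.inner_nablaEndo_Phi hZ hY, hskew Y Z,
    hskew (nabla g T X Y) Z, hskew Y (nabla g T X Z)]
  have : dirDeriv X (fun y ↦ -pair g ((Phi g T ξ).app Z) Y y) x =
      -dirDeriv X (pair g ((Phi g T ξ).app Z) Y) x := by
    simp only [dirDeriv]
    rw [mvfderiv_fun_neg]
    rfl
  rw [this]
  ring

/-- The curvature `R^T(X, Y)ξ` is the antisymmetrization of `∇^T Φ`, up to a torsion term. -/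
lemma curvature_eq_nablaEndo_Phi {X Y : VField I M}
    (hX : IsSmooth X) (hY : IsSmooth Y) (x : M) :
    curvature g T X Y ξ x = nablaEndo g T X (Phi g T ξ) Y x - nablaEndo g T Y (Phi g T ξ) X x
      + Phi g T ξ x (torsionVec g T x (X x) (Y x)) := by
  have hb : nabla g T (mlieBracket I X Y) ξ x = Phi g T ξ x (mlieBracket I X Y x) := rfl
  simp only [curvature, nablaEndo, Pi.sub_apply]
  rw [hb, mlieBracket_eq (hX.smoothAt x).mdifferentiableAt (hY.smoothAt x).mdifferentiableAt g T]
  have e : ∀ Z, (Phi g T ξ).app Z = nabla g T Z ξ := fun _ ↦ rfl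
  rw [e, e, e, e]
  simp only [map_sub, nabla, Phi]
  abel

/-- For `(c) → (b)`: the defect of (b), as a trilinear form, is skew-symmetric in its last two
arguments, and condition (c) makes it symmetric in its first two. Hence it vanishes. -/
lemma IsUnitKilling.condB_iff_condC (h : IsUnitKilling g ξ) : CondB g T ξ ↔ CondC g T ξ := by
  constructor
  · intro hB X Y hX hY x
    rw [curvature_eq_nablaEndo_Phi hX hY, hB X Y hX hY, hB Y X hY hX, pair_comm Y X]
    abel
  · intro hC X Y hX hY x
    let D : VField I M → VField I M → VField I M → ℝ := fun A B C ↦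
      g.inner x (nablaEndo g T A (Phi g T ξ) B x) (C x)
        - (pair g ξ B x * pair g A C x - pair g A B x * pair g ξ C x)
    have hsymm : ∀ A B C : VField I M, IsSmooth A → IsSmooth B → D A B C = D B A C := by
      intro A B C hA hB
      have h1 := hC A B hA hB x
      rw [curvature_eq_nablaEndo_Phi hA hB] at h1
      have h2 := congrArg (fun v ↦ g.inner x v (C x)) (add_right_cancel h1)
      simp only [map_sub, map_smul, sub_apply, smul_apply, smul_eq_mul] at h2
      simp only [D, pair_comm B A]
      simp only [pair] at h2 ⊢
      linarith
    have hskew : ∀ A B C : VField I M, IsSmooth B → IsSmooth C → D A B C = -D A C B := by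
      intro A B C hB hC
      simp only [D]
      rw [h.inner_nablaEndo_Phi_comm hB hC]
      ring
    apply eq_of_inner_eq (g := g)
    intro w
    obtain ⟨Z, hZ, rfl⟩ := exists_isSmooth_eq w
    have h1 := hsymm X Y Z hX hY
    have h2 := hskew Y X Z hX hZ
    have h3 := hsymm Y Z X hY hZ
    have h4 := hskew Z Y X hY hX
    have h5 := hsymm Z X Y hZ hX
    have h6 := hskew X Z Y hZ hY
    have h0 : D X Y Z = 0 := by linarith
    simp only [map_sub, map_smul, sub_apply, smul_apply, smul_eq_mul]
    exact sub_eq_zero.1 h0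

/-- Condition (b) with `Y = ξ` gives `Φ² = -1 + η ⊗ ξ`. -/
lemma IsUnitKilling.Phi_Phi (h : IsUnitKilling g ξ) (hB : CondB g T ξ) (x : M)
    (u : TangentSpace I x) :
    Phi g T ξ x (Phi g T ξ x u) = -u + g.inner x (ξ x) u • ξ x := by
  obtain ⟨X, hX, rfl⟩ := exists_isSmooth_eq u
  have h1 := hB X ξ hX h.smooth x
  have h2 : (Phi g T ξ).app ξ = 0 := funext fun y ↦ h.Phi_self T y
  have h3 : nabla g T X (0 : VField I M) = 0 := by
    ext y
    simp [nabla]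
  simp only [nablaEndo, h2, h3, zero_sub, Pi.neg_apply, pair, h.unit, one_smul] at h1
  rw [g.symm x (ξ x)]
  have h4 : Phi g T ξ x (Phi g T ξ x (X x)) = (Phi g T ξ).app (nabla g T X ξ) x := rfl
  rw [h4, ← neg_neg ((Phi g T ξ).app (nabla g T X ξ) x), h1]
  abel

end UnitKilling

/-! ### The metric cone -/

section ConeGeometry

variable {E : Type*} [NormedAddCommGroup E] [NormedSpace ℝ E]
  {H : Type*} [TopologicalSpace H] {I : ModelWithCorners ℝ E H}
  {M : Type*} [TopologicalSpace M] [ChartedSpace H M] [IsManifold I ∞ M]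

/-- The differential at `r` of the inclusion `ℝ₊ → ℝ`, as an endomorphism of the model space `ℝ`. -/
def inclDeriv (r : HalfLine) : ℝ →L[ℝ] ℝ :=
  mfderiv 𝓘(ℝ) 𝓘(ℝ) (Subtype.val : HalfLine → ℝ) r

/-- The tangent vector of the cone at `p` with `dproj = u` and `dr = c`, that is `u + c ∂_r`. -/
def coneVec (p : Cone M) (u : TangentSpace I p.1) (c : ℝ) : TangentSpace (I.prod 𝓘(ℝ)) p :=
  (u, c * (inclDeriv p.2 1)⁻¹)

@[simp] lemma dproj_coneVec (p : Cone M) (u : TangentSpace I p.1) (c : ℝ) :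
    dproj I p (coneVec p u c) = u := by
  rw [dproj_apply]
  rfl

@[simp] lemma dr_coneVec (p : Cone M) (u : TangentSpace I p.1) (c : ℝ) :
    dr I p (coneVec p u c) = c := by
  rw [dr_apply]
  have hD : inclDeriv p.2 1 ≠ 0 := fun h ↦ one_ne_zero (α := ℝ)
    (halfLine_mfderiv_injective p.2 (h.trans (map_zero (inclDeriv p.2)).symm))
  change inclDeriv p.2 (c * (inclDeriv p.2 1)⁻¹) = c
  have h := (inclDeriv p.2).map_smul (c * (inclDeriv p.2 1)⁻¹) 1
  rw [smul_eq_mul, mul_one, smul_eq_mul] at h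
  rw [h, mul_assoc, inv_mul_cancel₀ hD, mul_one]

lemma cone_ext {p : Cone M} {v w : TangentSpace (I.prod 𝓘(ℝ)) p}
    (h1 : dproj I p v = dproj I p w) (h2 : dr I p v = dr I p w) : v = w := by
  rw [← sub_eq_zero]
  exact eq_zero_of_dr_dproj (by rw [map_sub, h2, sub_self]) (by rw [map_sub, h1, sub_self])

lemma coneVec_eq_add (p : Cone M) (u : TangentSpace I p.1) (c : ℝ) :
    coneVec p u c = coneVec p u 0 + c • coneVec p 0 1 :=
  cone_ext (by simp) (by simp)

/-- The vector field `X + c ∂_r` on the cone, for a vector field `X` on `M` and a constant `c`. -/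
def coneField (X : VField I M) (c : ℝ) : VField (I.prod 𝓘(ℝ)) (Cone M) :=
  fun q ↦ coneVec q (X q.1) c

@[simp] lemma dproj_coneField (X : VField I M) (c : ℝ) (q : Cone M) :
    dproj I q (coneField X c q) = X q.1 :=
  dproj_coneVec ..

@[simp] lemma dr_coneField (X : VField I M) (c : ℝ) (q : Cone M) :
    dr I q (coneField X c q) = c :=
  dr_coneVec ..

/-- Smooth functions separate tangent vectors. -/
lemma eq_of_mvfderiv_eq {x : M} {u v : TangentSpace I x}
    (h : ∀ f : M → ℝ, ContMDiffAt I 𝓘(ℝ) ∞ f x → mvfderiv I f x u = mvfderiv I f x v) : u = v := by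
  have hinv := isInvertible_mfderiv_extChartAt (I := I) (mem_extChartAt_source (I := I) x)
  apply hinv.injective
  by_contra hne
  obtain ⟨φ, hφ⟩ := SeparatingDual.exists_separating_of_ne (R := ℝ) (V := E) hne
  have hφs : ContMDiffAt 𝓘(ℝ, E) 𝓘(ℝ) ∞ φ (extChartAt I x x) := φ.contMDiff.contMDiffAt
  have hc : ContMDiffAt I 𝓘(ℝ, E) ∞ (extChartAt I x) x := contMDiffAt_extChartAt
  apply hφ
  have h1 := h (φ ∘ extChartAt I x) (hφs.comp x hc)
  rw [mvfderiv_comp_apply x (hφs.mdifferentiableAt (by simp)) (hc.mdifferentiableAt (by simp)),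
    mvfderiv_comp_apply x (hφs.mdifferentiableAt (by simp)) (hc.mdifferentiableAt (by simp))] at h1
  simp only [mvfderiv, mfderiv_eq_fderiv, φ.fderiv] at h1
  exact h1

lemma mvfderiv_comp_fst {f : M → ℝ} {p : Cone M} (hf : MDiffAt f p.1)
    (u : TangentSpace (I.prod 𝓘(ℝ)) p) :
    mvfderiv (I.prod 𝓘(ℝ)) (fun q : Cone M ↦ f q.1) p u = mvfderiv I f p.1 (dproj I p u) :=
  mvfderiv_comp_apply p hf mdifferentiableAt_fst u

lemma mdifferentiableAt_comp_fst {f : M → ℝ} {p : Cone M} (hf : MDiffAt f p.1) :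
    MDifferentiableAt (I.prod 𝓘(ℝ)) 𝓘(ℝ) (fun q : Cone M ↦ f q.1) p :=
  MDifferentiableAt.comp p hf mdifferentiableAt_fst

lemma mdifferentiableAt_radius (p : Cone M) :
    MDifferentiableAt (I.prod 𝓘(ℝ)) 𝓘(ℝ) (radius : Cone M → ℝ) p :=
  (contMDiff_radius p).mdifferentiableAt (by simp)

lemma dirDeriv_congr {X : VField I M} {f f' : M → ℝ} {x : M} (h : f =ᶠ[𝓝 x] f') :
    dirDeriv X f x = dirDeriv X f' x := by
  simp only [dirDeriv, mvfderiv]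
  rw [h.mfderiv_eq]
  rfl

lemma dirDeriv_coneField_comp_fst {X : VField I M} {c : ℝ} {f : M → ℝ} {p : Cone M}
    (hf : ContMDiffAt I 𝓘(ℝ) ∞ f p.1) :
    dirDeriv (coneField X c) (fun q : Cone M ↦ f q.1) =ᶠ[𝓝 p] fun q ↦ dirDeriv X f q.1 := by
  filter_upwards [continuous_fst.continuousAt.eventually (eventually_mdifferentiableAt hf)] with q hq
  simp only [dirDeriv]
  rw [mvfderiv_comp_fst hq, dproj_coneField]

lemma dirDeriv_coneField_radius (X : VField I M) (c : ℝ) :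
    dirDeriv (coneField X c) (radius : Cone M → ℝ) = fun _ ↦ c :=
  funext fun q ↦ dr_coneField X c q

variable {g : Metric I M}

lemma contMDiffAt_inner_comp_fst {A B : Π q : Cone M, TangentSpace I q.1} {p : Cone M}
    (hA : ContMDiffAt (I.prod 𝓘(ℝ)) (I.prod 𝓘(ℝ, E)) ∞
      (fun q ↦ (TotalSpace.mk' E q.1 (A q) : TangentBundle I M)) p)
    (hB : ContMDiffAt (I.prod 𝓘(ℝ)) (I.prod 𝓘(ℝ, E)) ∞
      (fun q ↦ (TotalSpace.mk' E q.1 (B q) : TangentBundle I M)) p) :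
    ContMDiffAt (I.prod 𝓘(ℝ)) 𝓘(ℝ) ∞ (fun q ↦ g.inner q.1 (A q) (B q)) p := by
  have h1 : ContMDiffAt (I.prod 𝓘(ℝ)) (I.prod 𝓘(ℝ)) ∞ (fun q ↦ TotalSpace.mk' ℝ
      (E := Bundle.Trivial M ℝ) q.1 (g.inner q.1 (A q) (B q))) p := by
    apply ContMDiffAt.clm_bundle_apply₂ (F₁ := E) (F₂ := E)
    · exact ContMDiffAt.comp p g.contMDiff.contMDiffAt contMDiffAt_fst
    · exact hA
    · exact hB
  exact (contMDiffAt_totalSpace.1 h1).2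

variable [FiniteDimensional ℝ E]

lemma coneMetric_inner (g : Metric I M) (p : Cone M) (u v : TangentSpace (I.prod 𝓘(ℝ)) p) :
    (coneMetric g).inner p u v =
      dr I p u * dr I p v + radius p ^ 2 * g.inner p.1 (dproj I p u) (dproj I p v) := rfl

lemma smoothAt_coneField (g : Metric I M) {X : VField I M} {p : Cone M} (hX : SmoothAt X p.1)
    (c : ℝ) : SmoothAt (coneField X c) p := by
  apply smoothAt_of_pair (coneMetric g)
  intro Z hZ
  have e : pair (coneMetric g) (coneField X c) Z = fun q ↦
      c * dr I q (Z q) + radius q ^ 2 * g.inner q.1 (X q.1) (dproj I q (Z q)) := by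
    ext q
    simp [pair, coneMetric_inner]
  rw [e]
  exact (contMDiffAt_const.mul (contMDiffAt_dr hZ)).add ((contMDiff_radius.contMDiffAt.pow 2).mul
    (contMDiffAt_inner_comp_fst (ContMDiffAt.comp p hX contMDiffAt_fst) (contMDiffAt_dproj hZ)))

lemma isSmooth_coneField (g : Metric I M) {X : VField I M} (hX : IsSmooth X) (c : ℝ) :
    IsSmooth (coneField X c) :=
  fun p ↦ smoothAt_coneField g (hX.smoothAt p.1) c

/-- `[X + c ∂_r, Y + d ∂_r] = [X, Y]`. -/
lemma mlieBracket_coneField (g : Metric I M) {X Y : VField I M} {p : Cone M}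
    (hX : SmoothAt X p.1) (hY : SmoothAt Y p.1) (c d : ℝ) :
    mlieBracket (I.prod 𝓘(ℝ)) (coneField X c) (coneField Y d) p =
      coneVec p (mlieBracket I X Y p.1) 0 := by
  have hX' := smoothAt_coneField g hX c
  have hY' := smoothAt_coneField g hY d
  apply cone_ext
  · rw [dproj_coneVec]
    apply eq_of_mvfderiv_eq
    intro f hf
    rw [← mvfderiv_comp_fst (hf.mdifferentiableAt (by simp))]
    have h1 := dirDeriv_mlieBracket hX' hY'
      (f := fun q : Cone M ↦ f q.1) (ContMDiffAt.comp p hf contMDiffAt_fst)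
    have h2 := dirDeriv_mlieBracket hX hY hf
    rw [dirDeriv_congr (dirDeriv_coneField_comp_fst hf),
      dirDeriv_congr (dirDeriv_coneField_comp_fst hf),
      (dirDeriv_coneField_comp_fst (contMDiffAt_dirDeriv hY hf)).self_of_nhds,
      (dirDeriv_coneField_comp_fst (contMDiffAt_dirDeriv hX hf)).self_of_nhds, ← h2] at h1
    exact h1
  · rw [dr_coneVec]
    have h1 := dirDeriv_mlieBracket hX' hY' (f := radius) contMDiff_radius.contMDiffAt
    rw [dirDeriv_coneField_radius, dirDeriv_coneField_radius] at h1
    simp only [dirDeriv, mvfderiv_const] at h1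
    simp only [zero_apply, sub_zero] at h1
    exact h1

lemma pair_coneField (X Y : VField I M) (c d : ℝ) :
    pair (coneMetric g) (coneField X c) (coneField Y d) =
      fun q ↦ c * d + radius q ^ 2 * pair g X Y q.1 := by
  ext q
  simp [pair, coneMetric_inner]

lemma dirDeriv_pair_coneField {X Y Z : VField I M} {p : Cone M} (hY : SmoothAt Y p.1)
    (hZ : SmoothAt Z p.1) (a b c : ℝ) :
    dirDeriv (coneField X a) (pair (coneMetric g) (coneField Y b) (coneField Z c)) p =
      radius p ^ 2 * dirDeriv X (pair g Y Z) p.1 + 2 * radius p * a * pair g Y Z p.1 := by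
  have hp : MDiffAt (pair g Y Z) p.1 :=
    mdifferentiableAt_pair hY.mdifferentiableAt hZ.mdifferentiableAt
  have hr := mdifferentiableAt_radius (I := I) p
  have hd : mvfderiv (I.prod 𝓘(ℝ)) radius p (coneField X a p) = a := dr_coneField X a p
  have hrr : MDifferentiableAt (I.prod 𝓘(ℝ)) 𝓘(ℝ) (fun q : Cone M ↦ radius q * radius q) p :=
    hr.mul hr
  have hp' := mdifferentiableAt_comp_fst hp
  have hrp : MDifferentiableAt (I.prod 𝓘(ℝ)) 𝓘(ℝ)
      (fun q : Cone M ↦ radius q * radius q * pair g Y Z q.1) p := hrr.mul hp'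
  simp only [pair_coneField, dirDeriv, sq]
  rw [mvfderiv_fun_add mdifferentiableAt_const hrp, mvfderiv_const, mvfderiv_fun_mul hrr hp',
    mvfderiv_fun_mul hr hr]
  simp only [zero_add, add_apply, smul_apply, smul_eq_mul, hd]
  rw [mvfderiv_comp_fst hp, dproj_coneField]
  ring

/-- The Koszul expression of the cone metric on the fields `X + a ∂_r`. -/
lemma koszul_coneField {X Y Z : VField I M} {p : Cone M} (hX : SmoothAt X p.1)
    (hY : SmoothAt Y p.1) (hZ : SmoothAt Z p.1) (a b c : ℝ) :
    koszul (coneMetric g) (coneField X a) (coneField Y b) (coneField Z c) p =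
      radius p ^ 2 * koszul g X Y Z p.1 + radius p * (a * pair g Y Z p.1 + b * pair g X Z p.1
        - c * pair g X Y p.1) := by
  have hb : ∀ {A B C : VField I M} (a b c : ℝ), SmoothAt A p.1 → SmoothAt B p.1 →
      pair (coneMetric g) (mlieBracket (I.prod 𝓘(ℝ)) (coneField A a) (coneField B b))
        (coneField C c) p = radius p ^ 2 * pair g (mlieBracket I A B) C p.1 := by
    intro A B C a b c hA hB
    simp only [pair]
    rw [mlieBracket_coneField g hA hB]
    simp [coneMetric_inner]
  simp only [koszul]
  rw [hb a b c hX hY, hb a c b hX hZ, hb b c a hY hZ, dirDeriv_pair_coneField hY hZ,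
    dirDeriv_pair_coneField hX hZ, dirDeriv_pair_coneField hX hY]
  ring

/-- The connection on the cone with torsion `r² T`. -/
lemma torsionConnection_coneField (T : ThreeForm I M) {Y : VField I M} {p : Cone M}
    (hY : SmoothAt Y p.1) (b : ℝ) (u : TangentSpace (I.prod 𝓘(ℝ)) p) :
    torsionConnection (coneMetric g) (coneTorsion T) (coneField Y b) p u =
      coneVec p (torsionConnection g T Y p.1 (dproj I p u) + (dr I p u / radius p) • Y p.1
        + (b / radius p) • dproj I p u) (-radius p * g.inner p.1 (dproj I p u) (Y p.1)) := by
  obtain ⟨x, hx⟩ : ∃ x, dproj I p u = x := ⟨_, rfl⟩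
  obtain ⟨a, ha⟩ : ∃ a, dr I p u = a := ⟨_, rfl⟩
  obtain ⟨X, hX, rfl⟩ : ∃ X : VField I M, SmoothAt X p.1 ∧ X p.1 = x :=
    ⟨extend E x, smoothAt_extend x, extend_apply_self E x⟩
  have hu : u = coneField X a p := cone_ext (by simp [hx]) (by simp [ha])
  apply eq_of_inner_eq (g := coneMetric g)
  intro w
  obtain ⟨z, hz⟩ : ∃ z, dproj I p w = z := ⟨_, rfl⟩
  obtain ⟨c, hc⟩ : ∃ c, dr I p w = c := ⟨_, rfl⟩
  obtain ⟨Z, hZ, rfl⟩ : ∃ Z : VField I M, SmoothAt Z p.1 ∧ Z p.1 = z :=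
    ⟨extend E z, smoothAt_extend z, extend_apply_self E z⟩
  have hw : w = coneField Z c p := cone_ext (by simp [hz]) (by simp [hc])
  have hr := (radius_pos p).ne'
  rw [hu, hw, inner_torsionConnection_eq_koszul (smoothAt_coneField g hX a).mdifferentiableAt
    (smoothAt_coneField g hY b).mdifferentiableAt (smoothAt_coneField g hZ c).mdifferentiableAt,
    koszul_coneField hX hY hZ, coneTorsion_eval, coneMetric_inner]
  simp only [dproj_coneField, dr_coneField, dproj_coneVec, dr_coneVec, map_add, map_smul,
    add_apply, smul_apply, smul_eq_mul]
  rw [inner_torsionConnection_eq_koszul hX.mdifferentiableAt hY.mdifferentiableAt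
    hZ.mdifferentiableAt]
  simp only [pair]
  field_simp
  ring

end ConeGeometry

/-! ### The complex structure of the cone of a unit Killing field -/

section ConeComplexStructure

variable {E : Type*} [NormedAddCommGroup E] [NormedSpace ℝ E] [FiniteDimensional ℝ E]
  {H : Type*} [TopologicalSpace H] {I : ModelWithCorners ℝ E H}
  {M : Type*} [TopologicalSpace M] [ChartedSpace H M] [IsManifold I ∞ M]
  (g : Metric I M) (T : ThreeForm I M) (ξ : VField I M)

/-- The endomorphism field `J` of the tangent spaces of the cone determined by `ξ`:
`J(X) = Φ(X) - r η(X) ∂_r` for `X` tangent to `M`, and `J(r ∂_r) = ξ`. -/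
def coneJ : EndoField (I.prod 𝓘(ℝ)) (Cone M) := fun p ↦
  haveI : FiniteDimensional ℝ (TangentSpace (I.prod 𝓘(ℝ)) p) :=
    inferInstanceAs (FiniteDimensional ℝ (E × ℝ))
  haveI : T2Space (TangentSpace (I.prod 𝓘(ℝ)) p) := inferInstanceAs (T2Space (E × ℝ))
  LinearMap.toContinuousLinearMap
    { toFun := fun v ↦ coneVec p
        (Phi g T ξ p.1 (dproj I p v) + (dr I p v / radius p) • ξ p.1)
        (-radius p * g.inner p.1 (ξ p.1) (dproj I p v))
      map_add' := fun v w ↦ cone_ext (by simp; module) (by simp; ring)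
      map_smul' := fun c v ↦ cone_ext (by simp; module) (by simp; ring) }

@[simp] lemma dproj_coneJ (p : Cone M) (v : TangentSpace (I.prod 𝓘(ℝ)) p) :
    dproj I p (coneJ g T ξ p v) =
      Phi g T ξ p.1 (dproj I p v) + (dr I p v / radius p) • ξ p.1 :=
  dproj_coneVec ..

@[simp] lemma dr_coneJ (p : Cone M) (v : TangentSpace (I.prod 𝓘(ℝ)) p) :
    dr I p (coneJ g T ξ p v) = -radius p * g.inner p.1 (ξ p.1) (dproj I p v) :=
  dr_coneVec ..

variable {g ξ} {T : ThreeForm I M}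

lemma contMDiffAt_Phi (hξ : IsSmooth ξ) (x : M) :
    ContMDiffAt I (I.prod 𝓘(ℝ, E →L[ℝ] E)) ∞ (fun x ↦ TotalSpace.mk' (E →L[ℝ] E)
      (E := fun x : M ↦ TangentSpace I x →L[ℝ] TangentSpace I x) x (Phi g T ξ x)) x :=
  contMDiffAt_hom_of_apply _ x fun _ hX ↦ hX.nabla (hξ.smoothAt x) g T

lemma contMDiff_coneJ (hξ : IsSmooth ξ) :
    ContMDiff (I.prod 𝓘(ℝ)) ((I.prod 𝓘(ℝ)).prod 𝓘(ℝ, E × ℝ →L[ℝ] E × ℝ)) ∞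
      (fun p ↦ TotalSpace.mk' (E × ℝ →L[ℝ] E × ℝ)
        (E := fun p : Cone M ↦ TangentSpace (I.prod 𝓘(ℝ)) p →L[ℝ] TangentSpace (I.prod 𝓘(ℝ)) p)
        p (coneJ g T ξ p)) := by
  intro p
  apply contMDiffAt_hom_of_apply
  intro X hX
  apply smoothAt_of_pair (coneMetric g)
  intro Z hZ
  have e : pair (coneMetric g) (fun q ↦ coneJ g T ξ q (X q)) Z = fun q ↦
      -radius q * g.inner q.1 (ξ q.1) (dproj I q (X q)) * dr I q (Z q) +
        radius q ^ 2 * (g.inner q.1 (Phi g T ξ q.1 (dproj I q (X q))) (dproj I q (Z q)) +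
          (dr I q (X q) * (radius q)⁻¹) * g.inner q.1 (ξ q.1) (dproj I q (Z q))) := by
    ext q
    simp [pair, coneMetric_inner, div_eq_mul_inv]
  rw [e]
  have hr : ContMDiffAt (I.prod 𝓘(ℝ)) 𝓘(ℝ) ∞ (radius : Cone M → ℝ) p :=
    contMDiff_radius.contMDiffAt
  have hξ' : ContMDiffAt (I.prod 𝓘(ℝ)) (I.prod 𝓘(ℝ, E)) ∞
      (fun q : Cone M ↦ (TotalSpace.mk' E q.1 (ξ q.1) : TangentBundle I M)) p :=
    ContMDiffAt.comp p (hξ.smoothAt p.1) contMDiffAt_fst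
  have hΦ : ContMDiffAt (I.prod 𝓘(ℝ)) (I.prod 𝓘(ℝ, E)) ∞ (fun q : Cone M ↦
      (TotalSpace.mk' E q.1 (Phi g T ξ q.1 (dproj I q (X q))) : TangentBundle I M)) p :=
    ContMDiffAt.clm_bundle_apply (b := fun q : Cone M ↦ q.1)
      (ContMDiffAt.comp p (contMDiffAt_Phi hξ p.1) contMDiffAt_fst) (contMDiffAt_dproj hX)
  exact ((hr.neg.mul (contMDiffAt_inner_comp_fst hξ' (contMDiffAt_dproj hX))).mul
    (contMDiffAt_dr hZ)).add ((hr.pow 2).mul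
      ((contMDiffAt_inner_comp_fst hΦ (contMDiffAt_dproj hZ)).add
        (((contMDiffAt_dr hX).mul (hr.inv₀ (radius_pos p).ne')).mul
          (contMDiffAt_inner_comp_fst hξ' (contMDiffAt_dproj hZ)))))

lemma coneJ_app_coneField (Y : VField I M) (b : ℝ) :
    (coneJ g T ξ).app (coneField Y b) = coneField ((Phi g T ξ).app Y) 0 +
      ((fun q : Cone M ↦ b * (radius q)⁻¹) • coneField ξ 0 +
        (fun q : Cone M ↦ -(radius q * pair g ξ Y q.1)) • coneField (0 : VField I M) 1) := by
  ext1 q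
  apply cone_ext
  · simp [EndoField.app, div_eq_mul_inv]
  · simp [EndoField.app, pair]

lemma mvfderiv_const_mul_inv_radius (p : Cone M) (b : ℝ) (u : TangentSpace (I.prod 𝓘(ℝ)) p) :
    MDifferentiableAt (I.prod 𝓘(ℝ)) 𝓘(ℝ) (fun q : Cone M ↦ b * (radius q)⁻¹) p ∧
    mvfderiv (I.prod 𝓘(ℝ)) (fun q : Cone M ↦ b * (radius q)⁻¹) p u =
      -(b / radius p ^ 2 * dr I p u) := by
  have hr := (radius_pos p).ne'
  have h1 : HasDerivAt (fun s : ℝ ↦ b * s⁻¹) (b * -(radius p ^ 2)⁻¹) (radius p) :=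
    (hasDerivAt_inv hr).const_mul b
  have hd : MDifferentiableAt 𝓘(ℝ) 𝓘(ℝ) (fun s : ℝ ↦ b * s⁻¹) (radius p) :=
    h1.differentiableAt.mdifferentiableAt
  have h2 := mvfderiv_comp_apply p hd (mdifferentiableAt_radius (I := I) p) u
  refine ⟨hd.comp p (mdifferentiableAt_radius (I := I) p), h2.trans ?_⟩
  simp only [mvfderiv, mfderiv_eq_fderiv, h1.hasFDerivAt.fderiv]
  change dr I p u * (b * -(radius p ^ 2)⁻¹) = _
  field_simp

variable [T2Space M]

/-- The complex structure of the cone is parallel. -/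
lemma torsionConnection_coneJ (h : IsUnitKilling g ξ) (hB : CondB g T ξ)
    {Y : VField (I.prod 𝓘(ℝ)) (Cone M)} {p : Cone M} (hY : SmoothAt Y p)
    (u : TangentSpace (I.prod 𝓘(ℝ)) p) :
    torsionConnection (coneMetric g) (coneTorsion T) ((coneJ g T ξ).app Y) p u =
      coneJ g T ξ p (torsionConnection (coneMetric g) (coneTorsion T) Y p u) := by
  have hJ := contMDiff_coneJ (g := g) (T := T) h.smooth
  have htens := tensorialAt_nablaEndo (g := coneMetric g) (T := coneTorsion T) (x := p)
    (fun Y hY ↦ hJ.mdifferentiableAt_endoField_app hY) u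
  rw [← sub_eq_zero]
  -- By tensoriality it suffices to consider the fields `X + b ∂_r`.
  obtain ⟨Y', hY', hYp⟩ := exists_isSmooth_eq (dproj I p (Y p))
  obtain ⟨b, hb⟩ : ∃ b, dr I p (Y p) = b := ⟨_, rfl⟩
  have hc := isSmooth_coneField g hY' b
  have hval : Y p = coneField Y' b p := cone_ext (by simp [hYp]) (by simp [hb])
  refine (htens.pointwise hY.mdifferentiableAt (hc.smoothAt p).mdifferentiableAt hval).trans ?_
  rw [sub_eq_zero]
  obtain ⟨X, hX, hXp⟩ := exists_isSmooth_eq (dproj I p u)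
  have hcond := hB X Y' hX hY' p.1
  simp only [nablaEndo, Pi.sub_apply, nabla, hXp] at hcond
  have hr := (radius_pos p).ne'
  obtain ⟨hinv, hinv'⟩ := mvfderiv_const_mul_inv_radius (I := I) p b u
  have hη : MDiffAt (pair g ξ Y') p.1 := mdifferentiableAt_pair
    (h.smooth.smoothAt p.1).mdifferentiableAt (hY'.smoothAt p.1).mdifferentiableAt
  have hη' := mdifferentiableAt_comp_fst hη
  have hrad := mdifferentiableAt_radius (I := I) p
  have hrη : MDifferentiableAt (I.prod 𝓘(ℝ)) 𝓘(ℝ)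
      (fun q : Cone M ↦ radius q * pair g ξ Y' q.1) p := hrad.mul hη'
  have hnrη : MDifferentiableAt (I.prod 𝓘(ℝ)) 𝓘(ℝ)
      (fun q : Cone M ↦ -(radius q * pair g ξ Y' q.1)) p := hrη.neg
  have h0 : IsSmooth (0 : VField I M) := isSmooth_zero
  have hΦY := h.isSmooth_app_Phi T hY'
  have hd1 := ((isSmooth_coneField g hΦY 0).smoothAt p).mdifferentiableAt
  have hd2 := ((isSmooth_coneField g h.smooth 0).smoothAt p).mdifferentiableAt
  have hd3 := ((isSmooth_coneField g h0 1).smoothAt p).mdifferentiableAt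
  have hd2' := hinv.smul_section hd2
  have hd3' := hnrη.smul_section hd3
  rw [coneJ_app_coneField, torsionConnection_add hd1 (mdifferentiableAt_add_section hd2' hd3'),
    torsionConnection_add hd2' hd3', torsionConnection_smul hinv hd2,
    torsionConnection_smul hnrη hd3, torsionConnection_coneField T (hΦY.smoothAt p.1),
    torsionConnection_coneField T (h.smooth.smoothAt p.1),
    torsionConnection_coneField T (h0.smoothAt p.1),
    torsionConnection_coneField T (hY'.smoothAt p.1), hinv', mvfderiv_fun_neg,
    mvfderiv_fun_mul hrad hη']
  have hdr : mvfderiv (I.prod 𝓘(ℝ)) radius p u = dr I p u := rfl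
  simp only [neg_apply, add_apply, smul_apply, smul_eq_mul, hdr]
  rw [mvfderiv_comp_fst hη, mvfderiv_pair (h.smooth.smoothAt p.1).mdifferentiableAt
    (hY'.smoothAt p.1).mdifferentiableAt T]
  have hskew := h.inner_Phi T p.1 (dproj I p u) (Y' p.1)
  simp only [Phi] at hskew
  rw [hskew]
  have hcond' := eq_add_of_sub_eq hcond
  have hnab : (Phi g T ξ).app (nabla g T X Y') p.1 =
      torsionConnection g T ξ p.1 (torsionConnection g T Y' p.1 (dproj I p u)) := by
    simp only [EndoField.app, nabla, Phi, hXp]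
  have hΦ : (Phi g T ξ).app Y' p.1 = torsionConnection g T ξ p.1 (Y' p.1) := rfl
  have hX0 : pair g X Y' p.1 = g.inner p.1 (dproj I p u) (Y' p.1) := by rw [pair, hXp]
  rw [hnab, hX0] at hcond'
  apply cone_ext
  · simp only [Phi] at hcond' hΦ ⊢
    simp only [hcond', map_add, map_smul, dproj_coneVec, dproj_coneField, dproj_coneJ, dr_coneVec,
      Phi, CovariantDerivative.zero, Pi.zero_apply, zero_apply, smul_zero, hΦ]
    match_scalars <;> field_simp <;> ring
  · simp only [Phi] at hΦ
    simp only [Phi, map_add, map_smul, dr_coneVec, dr_coneField, dr_coneJ, dproj_coneVec, smul_eq_mul,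
      Pi.zero_apply, map_zero, hΦ, pair]
    rw [g.symm p.1 (ξ p.1) (dproj I p u)]
    field_simp
    ring

lemma inner_coneJ (h : IsUnitKilling g ξ) (hB : CondB g T ξ) (p : Cone M)
    (u v : TangentSpace (I.prod 𝓘(ℝ)) p) :
    (coneMetric g).inner p (coneJ g T ξ p u) (coneJ g T ξ p v) = (coneMetric g).inner p u v := by
  have h1 := h.inner_Phi T p.1 (dproj I p u) (Phi g T ξ p.1 (dproj I p v))
  have hr := (radius_pos p).ne'
  rw [h.Phi_Phi hB] at h1
  simp only [coneMetric_inner, dr_coneJ, dproj_coneJ, map_add, map_smul, add_apply, smul_apply,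
    smul_eq_mul, h.inner_Phi_self, h.unit, g.symm p.1 (ξ p.1) (Phi g T ξ p.1 _), h1, map_neg,
    g.symm p.1 _ (ξ p.1)]
  field_simp
  ring

lemma coneJ_coneJ (h : IsUnitKilling g ξ) (hB : CondB g T ξ) (p : Cone M)
    (u : TangentSpace (I.prod 𝓘(ℝ)) p) : coneJ g T ξ p (coneJ g T ξ p u) = -u := by
  have hr := (radius_pos p).ne'
  apply cone_ext
  · simp only [dproj_coneJ, dr_coneJ, map_add, map_smul, h.Phi_Phi hB, h.Phi_self, smul_zero,
      map_neg, neg_mul, neg_div, mul_div_cancel_left₀ _ hr]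
    module
  · simp only [dproj_coneJ, dr_coneJ, map_add, map_smul, g.symm p.1 (ξ p.1) (Phi g T ξ p.1 _),
      h.inner_Phi_self, h.unit, map_neg, smul_eq_mul]
    field_simp
    ring

/-- The compatibility identity with `ξ` in its first slot; it makes the Nijenhuis tensor of the
cone vanish on pairs of vectors one of which is radial. -/
lemma TorsionCompat.eval_Phi (hT : TorsionCompat g T ξ) (h : IsUnitKilling g ξ)
    (hB : CondB g T ξ) (x : M) (u v : TangentSpace I x) :
    T.eval x (ξ x) (Phi g T ξ x u) v = -T.eval x (ξ x) u (Phi g T ξ x v) := by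
  rw [hT x (ξ x) (Phi g T ξ x u) v, h.Phi_self, h.Phi_Phi hB, T.eval_add_mid, T.eval_smul_mid,
    ← neg_one_smul ℝ u, T.eval_smul_mid]
  simp

lemma nijenhuis_coneJ (h : IsUnitKilling g ξ) (hB : CondB g T ξ) (hT : TorsionCompat g T ξ)
    {X Y : VField (I.prod 𝓘(ℝ)) (Cone M)} (hX : IsSmooth X) (hY : IsSmooth Y) :
    nijenhuis (coneJ g T ξ) X Y = 0 := by
  ext1 p
  have hJ := contMDiff_coneJ (g := g) (T := T) h.smooth
  have hXd := (hX.smoothAt p).mdifferentiableAt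
  have hYd := (hY.smoothAt p).mdifferentiableAt
  rw [nijenhuis_eq (coneJ_coneJ h hB p) hXd hYd (hJ.mdifferentiableAt_endoField_app hXd)
    (hJ.mdifferentiableAt_endoField_app hYd) (torsionConnection_coneJ h hB (hX.smoothAt p))
    (torsionConnection_coneJ h hB (hY.smoothAt p))]
  apply eq_of_inner_eq (g := coneMetric g)
  intro w
  have hskew : ∀ v, (coneMetric g).inner p (coneJ g T ξ p v) w =
      -(coneMetric g).inner p v (coneJ g T ξ p w) := by
    intro v
    rw [← inner_coneJ h hB p v, coneJ_coneJ h hB, map_neg, neg_neg]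
  simp only [map_add, map_sub, add_apply, sub_apply, hskew, inner_torsionVec, coneTorsion_eval,
    dproj_coneJ, Pi.zero_apply, map_zero, zero_apply]
  generalize dproj I p (X p) = x
  generalize dproj I p (Y p) = y
  generalize dproj I p w = z
  generalize dr I p (X p) / radius p = a
  generalize dr I p (Y p) / radius p = b
  generalize dr I p w / radius p = c
  have h1 := hT p.1 x y z
  have h2 := hT.eval_Phi h hB p.1
  have e1 : ∀ u v, T.eval p.1 u (ξ p.1) v = -T.eval p.1 (ξ p.1) u v := fun u v ↦
    T.eval_swap_left p.1 (ξ p.1) u v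
  have e2 : ∀ u v, T.eval p.1 u v (ξ p.1) = T.eval p.1 (ξ p.1) u v := fun u v ↦ by
    rw [T.eval_swap_right, e1, neg_neg]
  simp only [T.eval_add_left, T.eval_add_mid, T.eval_add_right, T.eval_smul_left,
    T.eval_smul_mid, T.eval_smul_right, T.eval_self_left, T.eval_self_right, T.eval_self_outer]
  rw [e1 (Phi g T ξ p.1 x), e1 x, e2 (Phi g T ξ p.1 x), e2 x, h1, h2 y z, h2 x z, h2 x y]
  ring

theorem isSasakiWithTorsion_of_condB (h : IsUnitKilling g ξ) (hB : CondB g T ξ)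
    (hT : TorsionCompat g T ξ) : IsSasakiWithTorsion g T := by
  refine ⟨coneJ g T ξ, ⟨⟨contMDiff_coneJ h.smooth, coneJ_coneJ h hB, fun X Y hX hY ↦
    nijenhuis_coneJ h hB hT hX hY⟩, inner_coneJ h hB⟩, fun X Y _ hY ↦ ?_⟩
  ext1 p
  exact sub_eq_zero.2 (torsionConnection_coneJ h hB (hY.smoothAt p) (X p))

end ConeComplexStructure

/-! ### The hypersurface of radius one in the cone -/

section Slice

variable {E : Type*} [NormedAddCommGroup E] [NormedSpace ℝ E] [FiniteDimensional ℝ E]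
  {H : Type*} [TopologicalSpace H] {I : ModelWithCorners ℝ E H}
  {M : Type*} [TopologicalSpace M] [ChartedSpace H M] [IsManifold I ∞ M]

/-- The inclusion of `M` into the cone as the hypersurface `r = 1`. -/
def unitSlice (x : M) : Cone M := (x, ⟨1, one_pos (α := ℝ)⟩)

@[simp] lemma radius_unitSlice (x : M) : radius (unitSlice x) = 1 := rfl

lemma contMDiff_unitSlice : ContMDiff I (I.prod 𝓘(ℝ)) ∞ (unitSlice : M → Cone M) := by
  unfold unitSlice
  exact contMDiff_id.prodMk contMDiff_const

/-- The tangent vector `u + c ∂_r` of the cone at a point of the hypersurface `r = 1`. -/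
def sliceVec (x : M) (u : TangentSpace I x) (c : ℝ) : TangentSpace (I.prod 𝓘(ℝ)) (unitSlice x) :=
  coneVec (unitSlice x) u c

variable (I) in
/-- The component tangent to `M` of a tangent vector of the cone at a point with `r = 1`. -/
def sliceProj (x : M) : TangentSpace (I.prod 𝓘(ℝ)) (unitSlice x) →L[ℝ] TangentSpace I x :=
  dproj I (unitSlice x)

variable (I) in
/-- The radial component of a tangent vector of the cone at a point with `r = 1`. -/
def sliceDr (x : M) : TangentSpace (I.prod 𝓘(ℝ)) (unitSlice x) →L[ℝ] ℝ :=
  dr I (unitSlice x)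

@[simp] lemma sliceProj_sliceVec (x : M) (u : TangentSpace I x) (c : ℝ) :
    sliceProj I x (sliceVec x u c) = u :=
  dproj_coneVec (unitSlice x) u c

@[simp] lemma sliceDr_sliceVec (x : M) (u : TangentSpace I x) (c : ℝ) :
    sliceDr I x (sliceVec x u c) = c :=
  dr_coneVec (unitSlice x) u c

lemma slice_ext {x : M} {v w : TangentSpace (I.prod 𝓘(ℝ)) (unitSlice x)}
    (h1 : sliceProj I x v = sliceProj I x w) (h2 : sliceDr I x v = sliceDr I x w) : v = w :=
  cone_ext h1 h2

lemma sliceVec_eq_add (x : M) (u : TangentSpace I x) (c : ℝ) :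
    sliceVec x u c = sliceVec x u 0 + c • sliceVec x 0 1 :=
  coneVec_eq_add (unitSlice x) u c

lemma mfderiv_unitSlice (x : M) (u : TangentSpace I x) :
    mfderiv I (I.prod 𝓘(ℝ)) unitSlice x u = sliceVec x u 0 := by
  have hs : MDifferentiableAt I (I.prod 𝓘(ℝ)) (unitSlice : M → Cone M) x :=
    (contMDiff_unitSlice x).mdifferentiableAt (by simp)
  apply slice_ext
  · rw [sliceProj_sliceVec]
    have h := mfderiv_comp_apply (I'' := I) x
      (mdifferentiableAt_fst (I := I) (I' := 𝓘(ℝ)) (x := unitSlice x)) hs u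
    have e : Prod.fst ∘ (unitSlice : M → Cone M) = id := rfl
    rw [e, mfderiv_id] at h
    exact h.symm
  · rw [sliceDr_sliceVec]
    have h := mvfderiv_comp_apply x (mdifferentiableAt_radius (I := I) (unitSlice x)) hs u
    have e : radius ∘ (unitSlice : M → Cone M) = fun _ ↦ 1 := rfl
    rw [e, mvfderiv_const] at h
    exact h.symm

lemma mvfderiv_comp_unitSlice {F : Cone M → ℝ} {x : M}
    (hF : MDifferentiableAt (I.prod 𝓘(ℝ)) 𝓘(ℝ) F (unitSlice x)) (u : TangentSpace I x) :
    mvfderiv I (fun y ↦ F (unitSlice y)) x u =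
      mvfderiv (I.prod 𝓘(ℝ)) F (unitSlice x) (sliceVec x u 0) := by
  rw [← mfderiv_unitSlice]
  exact mvfderiv_comp_apply x hF ((contMDiff_unitSlice x).mdifferentiableAt (by simp)) u

/-- The vector field `J(∂_r)` along the hypersurface `r = 1`, projected to `M`. -/
def reeb (J : EndoField (I.prod 𝓘(ℝ)) (Cone M)) : VField I M :=
  fun x ↦ sliceProj I x (J (unitSlice x) (sliceVec x 0 1))

variable {g : Metric I M} {T : ThreeForm I M} {J : EndoField (I.prod 𝓘(ℝ)) (Cone M)}

lemma inner_unitSlice (g : Metric I M) (x : M)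
    (u v : TangentSpace (I.prod 𝓘(ℝ)) (unitSlice x)) :
    (coneMetric g).inner (unitSlice x) u v = sliceDr I x u * sliceDr I x v +
      g.inner x (sliceProj I x u) (sliceProj I x v) := by
  rw [coneMetric_inner, radius_unitSlice, one_pow, one_mul, sliceDr, sliceProj, unitSlice]

lemma coneTorsion_eval_unitSlice (T : ThreeForm I M) (x : M)
    (u v w : TangentSpace (I.prod 𝓘(ℝ)) (unitSlice x)) :
    (coneTorsion T).eval (unitSlice x) u v w =
      T.eval x (sliceProj I x u) (sliceProj I x v) (sliceProj I x w) := by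
  rw [coneTorsion_eval, radius_unitSlice, one_pow, one_mul, sliceProj, unitSlice]

lemma torsionConnection_coneField_unitSlice (T : ThreeForm I M) {Y : VField I M} {x : M}
    (hY : SmoothAt Y x) (b : ℝ) (u : TangentSpace I x) :
    torsionConnection (coneMetric g) (coneTorsion T) (coneField Y b) (unitSlice x)
      (sliceVec x u 0) =
      sliceVec x (torsionConnection g T Y x u + b • u) (-g.inner x u (Y x)) := by
  rw [torsionConnection_coneField T (p := unitSlice x) hY]
  have h1 : dproj I (unitSlice x) (sliceVec x u 0) = u := sliceProj_sliceVec x u 0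
  have h2 : dr I (unitSlice x) (sliceVec x u 0) = 0 := sliceDr_sliceVec x u 0
  rw [h1, h2, radius_unitSlice, zero_div, zero_smul, add_zero, div_one, neg_one_mul]
  rfl

lemma isSmooth_reeb (g : Metric I M) (hH : IsHermitian (coneMetric g) J) : IsSmooth (reeb J) := by
  intro x
  have h1 := hH.contMDiff.smoothAt_endoField_app
    ((isSmooth_coneField g (isSmooth_zero (I := I) (M := M)) 1).smoothAt (unitSlice x))
  exact ContMDiffAt.comp (f := unitSlice) x (contMDiffAt_dproj h1) contMDiff_unitSlice.contMDiffAt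

lemma IsHermitian.inner_skew {g : Metric I M} {J : EndoField I M} (hH : IsHermitian g J) (x : M)
    (u v : TangentSpace I x) : g.inner x (J x u) v = -g.inner x u (J x v) := by
  rw [← hH.hermitian x u, hH.sq, map_neg, neg_neg]

lemma sliceDr_J_radial (hH : IsHermitian (coneMetric g) J) (x : M) :
    sliceDr I x (J (unitSlice x) (sliceVec x 0 1)) = 0 := by
  have h1 := hH.inner_skew (unitSlice x) (sliceVec x 0 1) (sliceVec x 0 1)
  rw [(coneMetric g).symm _ _ (J _ _), inner_unitSlice] at h1
  simp only [sliceDr_sliceVec, sliceProj_sliceVec, map_zero, add_zero] at h1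
  linarith

lemma inner_reeb_reeb (hH : IsHermitian (coneMetric g) J) (x : M) :
    g.inner x (reeb J x) (reeb J x) = 1 := by
  have h1 := hH.hermitian (unitSlice x) (sliceVec x 0 1) (sliceVec x 0 1)
  rw [inner_unitSlice, inner_unitSlice, sliceDr_J_radial hH] at h1
  simpa [reeb] using h1

/-- `J(X)` has radial component `-η(X)`, for `X` tangent to the hypersurface `r = 1`. -/
lemma sliceDr_J_sliceVec (hH : IsHermitian (coneMetric g) J) (x : M) (u : TangentSpace I x) :
    sliceDr I x (J (unitSlice x) (sliceVec x u 0)) = -g.inner x u (reeb J x) := by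
  have h1 := hH.inner_skew (unitSlice x) (sliceVec x u 0) (sliceVec x 0 1)
  rw [inner_unitSlice, inner_unitSlice] at h1
  simpa [reeb] using h1

variable [T2Space M]

lemma torsionConnection_J (hP : IsBismutTorsion (coneMetric g) J (coneTorsion T))
    {V : VField (I.prod 𝓘(ℝ)) (Cone M)} (hV : IsSmooth V) (p : Cone M)
    (v : TangentSpace (I.prod 𝓘(ℝ)) p) :
    torsionConnection (coneMetric g) (coneTorsion T) (J.app V) p v =
      J p (torsionConnection (coneMetric g) (coneTorsion T) V p v) := by
  obtain ⟨X, hX, rfl⟩ := exists_isSmooth_eq v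
  exact sub_eq_zero.1 (congrFun (hP X V hX hV) p)

/-- The derivative of `g(A, Z)` where `A` is the component tangent to `M` of `J(Y + b ∂_r)` along
the hypersurface `r = 1`. This function is the restriction of a function on the cone, where `J` is
parallel. -/
lemma mvfderiv_pair_sliceProj_J (hH : IsHermitian (coneMetric g) J)
    (hP : IsBismutTorsion (coneMetric g) J (coneTorsion T)) {Y Z : VField I M} (hY : IsSmooth Y)
    (b : ℝ) (hZ : IsSmooth Z) (x : M) (u : TangentSpace I x) :
    mvfderiv I (pair g (fun y ↦ sliceProj I y (J (unitSlice y) (sliceVec y (Y y) b))) Z) x u =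
      g.inner x (sliceProj I x (J (unitSlice x) (sliceVec x
        (torsionConnection g T Y x u + b • u) (-g.inner x u (Y x))))) (Z x) +
      g.inner x (sliceProj I x (J (unitSlice x) (sliceVec x (Y x) b)))
        (torsionConnection g T Z x u) -
      g.inner x u (Z x) * sliceDr I x (J (unitSlice x) (sliceVec x (Y x) b)) := by
  have hY' := isSmooth_coneField g hY b
  have hZ' := isSmooth_coneField g hZ 0
  have hJY := (hH.contMDiff.smoothAt_endoField_app (hY'.smoothAt (unitSlice x))).mdifferentiableAt
  have hZd := (hZ'.smoothAt (unitSlice x)).mdifferentiableAt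
  have eY : ∀ y, J.app (coneField Y b) (unitSlice y) = J (unitSlice y) (sliceVec y (Y y) b) :=
    fun _ ↦ rfl
  have eZ : ∀ y, coneField Z 0 (unitSlice y) = sliceVec y (Z y) 0 := fun _ ↦ rfl
  have e : pair g (fun y ↦ sliceProj I y (J (unitSlice y) (sliceVec y (Y y) b))) Z =
      fun y ↦ pair (coneMetric g) (J.app (coneField Y b)) (coneField Z 0) (unitSlice y) := by
    ext y
    simp only [pair, eY, eZ, inner_unitSlice, sliceDr_sliceVec, sliceProj_sliceVec, mul_zero,
      zero_add]
  rw [e, mvfderiv_comp_unitSlice (mdifferentiableAt_pair hJY hZd), mvfderiv_pair hJY hZd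
    (coneTorsion T), torsionConnection_J hP hY', torsionConnection_coneField_unitSlice T
    (hY.smoothAt x), torsionConnection_coneField_unitSlice T (hZ.smoothAt x), eY, eZ,
    inner_unitSlice, inner_unitSlice]
  simp only [sliceDr_sliceVec, sliceProj_sliceVec, zero_smul, add_zero]
  ring

lemma Phi_reeb (hH : IsHermitian (coneMetric g) J)
    (hP : IsBismutTorsion (coneMetric g) J (coneTorsion T)) (x : M) (u : TangentSpace I x) :
    Phi g T (reeb J) x u = sliceProj I x (J (unitSlice x) (sliceVec x u 0)) := by
  apply eq_of_inner_eq (g := g)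
  intro w
  obtain ⟨Z, hZ, rfl⟩ := exists_isSmooth_eq w
  have h1 := mvfderiv_pair_sliceProj_J hH hP isSmooth_zero 1 hZ x u
  have h2 := mvfderiv_pair (g := g) ((isSmooth_reeb g hH).smoothAt x).mdifferentiableAt
    (hZ.smoothAt x).mdifferentiableAt T u
  have h3 := h2.symm.trans h1
  simp only [CovariantDerivative.zero, Pi.zero_apply, zero_apply, one_smul, zero_add, map_zero,
    neg_zero, sliceDr_J_radial hH, mul_zero, sub_zero] at h3
  exact add_right_cancel h3

lemma isUnitKilling_reeb (hH : IsHermitian (coneMetric g) J)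
    (hP : IsBismutTorsion (coneMetric g) J (coneTorsion T)) : IsUnitKilling g (reeb J) := by
  refine isUnitKilling_of_inner_Phi (isSmooth_reeb g hH) (inner_reeb_reeb hH) T fun x u v ↦ ?_
  have h1 := hH.inner_skew (unitSlice x) (sliceVec x u 0) (sliceVec x v 0)
  rw [inner_unitSlice, inner_unitSlice] at h1
  rw [Phi_reeb hH hP, Phi_reeb hH hP]
  simpa using h1

lemma condB_reeb (hH : IsHermitian (coneMetric g) J)
    (hP : IsBismutTorsion (coneMetric g) J (coneTorsion T)) : CondB g T (reeb J) := by
  intro X Y hX hY x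
  have hξ := isUnitKilling_reeb hH hP
  apply eq_of_inner_eq (g := g)
  intro w
  obtain ⟨Z, hZ, rfl⟩ := exists_isSmooth_eq w
  rw [hξ.inner_nablaEndo_Phi hY hZ]
  have h1 := mvfderiv_pair_sliceProj_J hH hP hY 0 hZ x (X x)
  have e : (Phi g T (reeb J)).app Y = fun y ↦ sliceProj I y
      (J (unitSlice y) (sliceVec y (Y y) 0)) := funext fun y ↦ Phi_reeb hH hP y (Y y)
  have hreeb : sliceProj I x (J (unitSlice x) (sliceVec x 0 1)) = reeb J x := rfl
  rw [← e, sliceDr_J_sliceVec hH, sliceVec_eq_add, map_add, map_add, map_smul, map_smul, hreeb,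
    zero_smul, add_zero, ← Phi_reeb hH hP, ← Phi_reeb hH hP] at h1
  rw [dirDeriv, h1]
  simp only [pair, EndoField.app, nabla, map_add, map_sub, map_smul, add_apply, sub_apply,
    smul_apply, smul_eq_mul, g.symm x (reeb J x) (Y x)]
  ring

lemma torsionCompat_reeb (hH : IsHermitian (coneMetric g) J)
    (hP : IsBismutTorsion (coneMetric g) J (coneTorsion T)) : TorsionCompat g T (reeb J) := by
  intro x u v w
  obtain ⟨X, hX, rfl⟩ := exists_isSmooth_eq u
  obtain ⟨Y, hY, rfl⟩ := exists_isSmooth_eq v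
  have hX' := isSmooth_coneField g hX 0
  have hY' := isSmooth_coneField g hY 0
  have hN := congrFun (hH.integrable _ _ hX' hY') (unitSlice x)
  have hXd := (hX'.smoothAt (unitSlice x)).mdifferentiableAt
  have hYd := (hY'.smoothAt (unitSlice x)).mdifferentiableAt
  rw [nijenhuis_eq (hH.sq _) hXd hYd (hH.contMDiff.mdifferentiableAt_endoField_app hXd)
    (hH.contMDiff.mdifferentiableAt_endoField_app hYd) (torsionConnection_J hP hX' _)
    (torsionConnection_J hP hY' _)] at hN
  have h1 := congrArg (fun v ↦ (coneMetric g).inner (unitSlice x) v (sliceVec x w 0)) hN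
  have eX : coneField X 0 (unitSlice x) = sliceVec x (X x) 0 := rfl
  have eY : coneField Y 0 (unitSlice x) = sliceVec x (Y x) 0 := rfl
  simp only [map_add, map_sub, add_apply, sub_apply, hH.inner_skew, inner_torsionVec,
    coneTorsion_eval_unitSlice, Pi.zero_apply, map_zero, zero_apply, eX, eY, sliceProj_sliceVec,
    ← Phi_reeb hH hP] at h1
  linarith

theorem isSasakiWithTorsion_iff : IsSasakiWithTorsion g T ↔
    ∃ ξ : VField I M, IsUnitKilling g ξ ∧ CondB g T ξ ∧ TorsionCompat g T ξ := by
  constructor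
  · rintro ⟨J, hH, hP⟩
    exact ⟨reeb J, isUnitKilling_reeb hH hP, condB_reeb hH hP, torsionCompat_reeb hH hP⟩
  · rintro ⟨ξ, hξ, hB, hT⟩
    exact isSasakiWithTorsion_of_condB hξ hB hT

end Slice

end

end SasakiTorsion

theorem proposition2p2
    {E : Type*} [NormedAddCommGroup E] [NormedSpace ℝ E] [FiniteDimensional ℝ E]
    {H : Type*} [TopologicalSpace H] (I : ModelWithCorners ℝ E H) [I.Boundaryless]
    (M : Type*) [TopologicalSpace M] [T2Space M] [ChartedSpace H M] [IsManifold I ∞ M]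
    (g : SasakiTorsion.Metric I M) (T : SasakiTorsion.ThreeForm I M) :
    (SasakiTorsion.IsSasakiWithTorsion g T ↔
      ∃ ξ : SasakiTorsion.VField I M, SasakiTorsion.IsUnitKilling g ξ ∧
        SasakiTorsion.CondA g T ξ ∧ SasakiTorsion.TorsionCompat g T ξ) ∧
    (SasakiTorsion.IsSasakiWithTorsion g T ↔
      ∃ ξ : SasakiTorsion.VField I M, SasakiTorsion.IsUnitKilling g ξ ∧
        SasakiTorsion.CondB g T ξ ∧ SasakiTorsion.TorsionCompat g T ξ) ∧
    (SasakiTorsion.IsSasakiWithTorsion g T ↔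
      ∃ ξ : SasakiTorsion.VField I M, SasakiTorsion.IsUnitKilling g ξ ∧
        SasakiTorsion.CondC g T ξ ∧ SasakiTorsion.TorsionCompat g T ξ) :=
  open SasakiTorsion in
  ⟨isSasakiWithTorsion_iff.trans (exists_congr fun _ ↦ and_congr_right fun h ↦
      and_congr_left' h.condA_iff_condB.symm),
    isSasakiWithTorsion_iff,
    isSasakiWithTorsion_iff.trans (exists_congr fun _ ↦ and_congr_right fun h ↦
      and_congr_left' h.condB_iff_condC)⟩
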